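/- Let $v\ge 9$ be odd, $\mathcal O=\mathbb C[[t]]$ with its $t$-adic valuation $\upsilon$, $R=\mathbb C[[t^6,t^8+t^v]]\subset\mathcal O$, and let $\Gamma=\upsilon(R\setminus\{0\})$ be its valuation semigroup. A (standard) $\Gamma$-module is a set $\Delta\subset\mathbb Z_{\ge 0}$ with $0\in\Delta$ and $\Gamma+\Delta\subset\Delta$. It is called admissible if $\Delta=\Delta_M:=\upsilon(M\setminus\{0\})$ for some $R$-submodule $M\subset\mathcal O$, and non-admissible otherwise. For $p>q$ in $\Delta$ and power series $m_p,m_q\in\mathcal O$ with leading terms $t^p,t^q$ (with coefficient $1$), say that $(m_p,m_q)$ satisfies the $(p,q)$-relations for $\Delta$ if for all $i,j\in\Gamma$ with $$i+p=j+q\quad\text{and}\quad i+p+(v-8)\notin\Delta$$ there are $\phi_i,\phi_j\in R$ with leading terms $t^i,t^j$ such that the difference $T^{pq}_{ij}=\phi_i m_p-\phi_j m_q$ satisfies $\upsilon(T^{pq}_{ij})>i+p+(v-8)$. (For $v=9$ the number $i+p+(v-8)$ is $i+p+1$.) Then a $\Gamma$-module $\Delta$ is non-admissible if and only if at least one of the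 following holds: (a) for some $p\in\{2,4,10\}$ with $p\in\Delta$, no pair $(m_p,m_0)$ satisfies the $(p,0)$-relations for $\Delta$; (b) $2,4\in\Delta$ and no pair $(m_4,m_2)$ satisfies the $(4,2)$-relations for $\Delta$; (c) $2,4\in\Delta$ and no triple $(m_0,m_2,m_4)$ is such that $(m_2,m_0)$, $(m_4,m_0)$ and $(m_4,m_2)$ simultaneously satisfy the $(2,0)$-, $(4,0)$- and $(4,2)$-relations for $\Delta$, respectively. Moreover, for every odd $v\ge 9$ there are exactly $46$ non-admissible $\Gamma$-modules. -/

import Mathlib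

namespace CompactifiedJacobian

noncomputable section

/-- The two generators `t^6` and `t^8 + t^v` of the ring. -/
def generators (v : ℕ) : Fin 2 → MvPowerSeries Unit ℂ :=
  ![(PowerSeries.X ^ 6 : PowerSeries ℂ), (PowerSeries.X ^ 8 + PowerSeries.X ^ v : PowerSeries ℂ)]

/-- Power series may be evaluated at the two generators: they have no constant term. -/
theorem hasSubst_generators {v : ℕ} (hv : 9 ≤ v) : MvPowerSeries.HasSubst (generators v) := by
  apply MvPowerSeries.hasSubst_of_constantCoeff_zero
  have hX : MvPowerSeries.constantCoeff (PowerSeries.X : PowerSeries ℂ) = 0 :=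
    MvPowerSeries.constantCoeff_X _
  intro s
  have hv0 : v ≠ 0 := by omega
  fin_cases s
  · change MvPowerSeries.constantCoeff ((PowerSeries.X : PowerSeries ℂ) ^ 6) = 0
    rw [map_pow, hX]
    norm_num
  · change MvPowerSeries.constantCoeff
      ((PowerSeries.X : PowerSeries ℂ) ^ 8 + (PowerSeries.X : PowerSeries ℂ) ^ v) = 0
    rw [map_add, map_pow, map_pow, hX, zero_pow hv0]
    norm_num

/-- The ring `R = ℂ[[t^6, t^8 + t^v]]`: the image of `ℂ[[x, y]]` in `𝒪 = ℂ[[t]]` under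
`x ↦ t^6`, `y ↦ t^8 + t^v`. -/
def ringR (v : ℕ) (hv : 9 ≤ v) : Subalgebra ℂ (PowerSeries ℂ) :=
  AlgHom.range (MvPowerSeries.substAlgHom (R := ℂ) (S := ℂ) (hasSubst_generators hv))

/-- The valuation semigroup `Γ` of `R`. -/
def semigroupΓ (v : ℕ) (hv : 9 ≤ v) : Set ℕ :=
  {n | ∃ f ∈ ringR v hv, f.order = (n : ℕ∞)}

/-- The set `Δ_M` of valuations of the (nonzero) elements of an `R`-submodule `M ⊆ 𝒪`. -/
def valuationSet {v : ℕ} {hv : 9 ≤ v} (M : Submodule (ringR v hv) (PowerSeries ℂ)) : Set ℕ :=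
  {n | ∃ f ∈ M, f.order = (n : ℕ∞)}

/-- Standard `Γ`-modules: `Δ ⊆ ℤ_{≥0}` with `0 ∈ Δ` and `Γ + Δ ⊆ Δ`. -/
def IsStandardModule (v : ℕ) (hv : 9 ≤ v) (Δ : Set ℕ) : Prop :=
  0 ∈ Δ ∧ ∀ g ∈ semigroupΓ v hv, ∀ d ∈ Δ, g + d ∈ Δ

/-- `Δ` is admissible if it is the set of valuations of some `R`-submodule `M ⊆ 𝒪`. -/
def IsAdmissible (v : ℕ) (hv : 9 ≤ v) (Δ : Set ℕ) : Prop :=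
  ∃ M : Submodule (ringR v hv) (PowerSeries ℂ), valuationSet M = Δ

/-- `f = t^n + (higher order terms)`. -/
def IsMonicOfOrder (f : PowerSeries ℂ) (n : ℕ) : Prop :=
  f.order = (n : ℕ∞) ∧ PowerSeries.coeff n f = 1

/-- The relations imposed by the pair `(p, q)` on `m_p`, `m_q`: for *all* `i, j ∈ Γ` with
`i + p = j + q` and `i + p + (v - 8) ∉ Δ`, the difference `T = φ_i m_p - φ_j m_q` has valuation
strictly greater than `i + p + (v - 8)` for suitable `φ_i, φ_j ∈ R` with leading terms
`t^i, t^j`. -/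
def Compatible (v : ℕ) (hv : 9 ≤ v) (Δ : Set ℕ) (p q : ℕ) (mp mq : PowerSeries ℂ) : Prop :=
  ∀ i ∈ semigroupΓ v hv, ∀ j ∈ semigroupΓ v hv, i + p = j + q → i + p + (v - 8) ∉ Δ →
    ∃ φi ∈ ringR v hv, ∃ φj ∈ ringR v hv, IsMonicOfOrder φi i ∧ IsMonicOfOrder φj j ∧
      ((i + p + (v - 8) : ℕ) : ℕ∞) < (φi * mp - φj * mq).order

/-- Obstruction from a single pair `p > q` of elements of `Δ` (types (a) and (b)): no `m_p, m_q`
satisfy all the relations for `(p, q)`. -/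
def PairObstructed (v : ℕ) (hv : 9 ≤ v) (Δ : Set ℕ) (p q : ℕ) : Prop :=
  p ∈ Δ ∧ q ∈ Δ ∧ ¬ ∃ mp mq : PowerSeries ℂ, IsMonicOfOrder mp p ∧ IsMonicOfOrder mq q ∧
    Compatible v hv Δ p q mp mq

/-- Obstruction from the three pairs from `{0, 2, 4} ⊆ Δ` taken together (type (c)). -/
def TripleObstructed (v : ℕ) (hv : 9 ≤ v) (Δ : Set ℕ) : Prop :=
  0 ∈ Δ ∧ 2 ∈ Δ ∧ 4 ∈ Δ ∧ ¬ ∃ m0 m2 m4 : PowerSeries ℂ,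
    IsMonicOfOrder m0 0 ∧ IsMonicOfOrder m2 2 ∧ IsMonicOfOrder m4 4 ∧
    Compatible v hv Δ 2 0 m2 m0 ∧ Compatible v hv Δ 4 0 m4 m0 ∧ Compatible v hv Δ 4 2 m4 m2

end

end CompactifiedJacobian

/-! Put `w = v - 8` (odd), `h = 1 + t^w`, `x = t^6`, `y = t^8 h`. The monomial `x^a y^b` has even
order and unit part `h^b`, so its first odd term is `b t^(6a+8b+w)`. Since `y^3 - x^4 = t^24 (h^3 -
1)` has order `w + 24`, the ring modulo `t^(w+24)` is spanned by the monomials with `b ≤ 2`, and an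
element of even order `i < 24` has its first odd coefficient prescribed by `i / 2 % 3`.

Obstructions. A relation `i + p = j + q` with `i, j < 24` therefore forces the unit part of `m_p /
m_q` to have odd part starting with `(b_j - b_i) t^w`. These numbers add under multiplication of
units. For the pairs (2,0), (4,0), (10,0), (4,2) the possible values are 1 or -2, -1 or 2, 2 or -1,
1 or -2; alternatives always differ by 3, as `h^3 ≠ 1`. Conflicting demands occur exactly in the
four configurations of `IsBad`: `obstructed_of_isBad` derives the conflict, and
`isBad_of_obstructed` exhibits monomials times powers of `h` satisfying all relations otherwise.

Bad implies non-admissible (`not_isAdmissible_of_isBad`). In a bad `Δ` every odd element is at least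
`w + 14`. After dividing by an element of order 0, the even coefficients of an element of `M` can be
cleared by elements without small odd terms, so a first odd coefficient outside `Δ` has to vanish.
This computes the odd terms of elements of order 2, 4, 10 and yields a contradiction.

Not bad implies admissible (`isAdmissible_of_not_isBad`). Take a triangular basis `t^n h^(c n)` in
even orders. The exponents can be chosen so that every failure of stability under `x` and `y` is a
ring multiple of a single defect `t^e h^s (h^3 - 1)` of order `e + w ∈ Δ`. The odd basis elements
carry a common unit, chosen so that the defect is absorbed by the odd part.

The same construction applied to the semigroup generated by 6, 8, `w + 24` shows that this semigroup
contains `Γ`. Hence counting is combinatorial: a bad `Δ` is determined by nine bits, with 46 valid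
patterns. -/

namespace CompactifiedJacobian

open PowerSeries

/-! ### The ring modulo powers of `t` -/

/-- The unit `1 + t^w`, so that the second generator of the ring is `t^8 (1 + t^w)`. -/
noncomputable abbrev hUnit (w : ℕ) : ℂ⟦X⟧ := 1 + X ^ w

theorem X_pow_six_mem_ringR {w : ℕ} (hv : 9 ≤ w + 8) : (X ^ 6 : ℂ⟦X⟧) ∈ ringR (w + 8) hv :=
  ⟨MvPowerSeries.X 0, by
    change MvPowerSeries.substAlgHom (hasSubst_generators hv) (MvPowerSeries.X 0) = _
    rw [MvPowerSeries.substAlgHom_X]; rfl⟩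

theorem X_pow_eight_mul_mem_ringR {w : ℕ} (hv : 9 ≤ w + 8) :
    (X ^ 8 * hUnit w : ℂ⟦X⟧) ∈ ringR (w + 8) hv :=
  ⟨MvPowerSeries.X 1, by
    change MvPowerSeries.substAlgHom (hasSubst_generators hv) (MvPowerSeries.X 1) = _
    rw [MvPowerSeries.substAlgHom_X]
    change (X ^ 8 + X ^ (w + 8) : ℂ⟦X⟧) = _
    ring⟩

/-- The monomial `x^a y^b` in the two generators. -/
noncomputable abbrev genMonomial (w a b : ℕ) : ℂ⟦X⟧ := X ^ (6 * a + 8 * b) * hUnit w ^ b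

theorem genMonomial_mem_ringR {w : ℕ} (hv : 9 ≤ w + 8) (a b : ℕ) :
    genMonomial w a b ∈ ringR (w + 8) hv := by
  have := mul_mem (pow_mem (X_pow_six_mem_ringR hv) a) (pow_mem (X_pow_eight_mul_mem_ringR hv) b)
  convert this using 1
  rw [genMonomial, mul_pow, pow_add, pow_mul, pow_mul]; ring

theorem X_dvd_generators (v : ℕ) (hv : 9 ≤ v) (s : Fin 2) :
    (X : ℂ⟦X⟧) ∣ generators v s := by
  fin_cases s
  · exact dvd_pow_self X (by norm_num)
  · exact dvd_add (dvd_pow_self X (by norm_num)) (dvd_pow_self X (by omega))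

/-- Modulo every power of `t`, an element of the ring is a polynomial in the generators. -/
theorem exists_polynomial_approx {v : ℕ} (hv : 9 ≤ v) (N : ℕ) {r : ℂ⟦X⟧} (hr : r ∈ ringR v hv) :
    ∃ p : MvPolynomial (Fin 2) ℂ, X ^ N ∣ r - MvPolynomial.aeval (generators v) p := by
  obtain ⟨F, rfl⟩ := hr
  refine ⟨MvPowerSeries.truncTotal N F, ?_⟩
  have h1 : MvPolynomial.aeval (generators v) (MvPowerSeries.truncTotal N F) =
      MvPowerSeries.substAlgHom (R := ℂ) (S := ℂ) (hasSubst_generators hv)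
        ((MvPowerSeries.truncTotal N F : MvPolynomial (Fin 2) ℂ) : MvPowerSeries (Fin 2) ℂ) := by
    rw [MvPowerSeries.coe_substAlgHom, MvPowerSeries.subst_coe]
  rw [X_pow_dvd_iff]
  intro n hn
  have h2 : (MvPowerSeries.substAlgHom (R := ℂ) (S := ℂ) (hasSubst_generators hv)).toRingHom F
      - MvPolynomial.aeval (generators v) (MvPowerSeries.truncTotal N F)
      = MvPowerSeries.subst (generators v) (F -
        ((MvPowerSeries.truncTotal N F : MvPolynomial (Fin 2) ℂ) : MvPowerSeries (Fin 2) ℂ)) := by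
    rw [h1, ← MvPowerSeries.coe_substAlgHom (hasSubst_generators hv), map_sub]; rfl
  refine (congrArg (coeff n) h2).trans ?_
  rw [PowerSeries.coeff, MvPowerSeries.coeff_subst (hasSubst_generators hv)]
  apply finsum_eq_zero_of_forall_eq_zero
  intro d
  by_cases hd : d.degree < N
  · rw [map_sub, MvPolynomial.coeff_coe, MvPowerSeries.coeff_truncTotal _ hd, sub_self, zero_smul]
  -- Both generators are divisible by `t`, so a monomial of degree at least `N` does not reach the
  -- coefficient `n < N`.
  · have hdvd : (X : ℂ⟦X⟧) ^ N ∣ d.prod fun s e => generators v s ^ e := by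
      refine (pow_dvd_pow X (not_lt.mp hd)).trans ?_
      rw [Finsupp.degree_eq_sum, Finsupp.prod_fintype _ _ (by simp), ← Finset.prod_pow_eq_pow_sum]
      exact Finset.prod_dvd_prod_of_dvd _ _ fun s _ => pow_dvd_pow_of_dvd (X_dvd_generators v hv s) _
    rw [show MvPowerSeries.coeff (Finsupp.single () n) (d.prod fun s e => generators v s ^ e) = 0
      from (X_pow_dvd_iff.mp hdvd) n hn, smul_zero]

/-- The power series of order at least `N`, as a complex vector space. -/
noncomputable def tail (N : ℕ) : Submodule ℂ ℂ⟦X⟧ where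
  carrier := {f | X ^ N ∣ f}
  add_mem' := dvd_add
  zero_mem' := dvd_zero _
  smul_mem' c f hf := by
    rw [PowerSeries.smul_eq_C_mul]; exact Dvd.dvd.mul_left hf _

/-- A ring element is a polynomial in the generators up to order `N`, and the space already contains
everything of order `N`. Stability under two multiplications thus replaces any convergence argument.
-/
theorem ringR_mul_mem {w : ℕ} {hv : 9 ≤ w + 8} {M : Submodule ℂ ℂ⟦X⟧} {N : ℕ} (hN : tail N ≤ M)
    (hx : ∀ f ∈ M, X ^ 6 * f ∈ M) (hy : ∀ f ∈ M, X ^ 8 * hUnit w * f ∈ M)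
    {r f : ℂ⟦X⟧} (hr : r ∈ ringR (w + 8) hv) (hf : f ∈ M) : r * f ∈ M := by
  obtain ⟨p, hp⟩ := exists_polynomial_approx hv N hr
  have key : ∀ p : MvPolynomial (Fin 2) ℂ, ∀ f ∈ M,
      MvPolynomial.aeval (generators (w + 8)) p * f ∈ M := by
    intro p
    induction p using MvPolynomial.induction_on with
    | C a =>
      intro f hf
      rw [MvPolynomial.aeval_C, ← Algebra.smul_def]
      exact M.smul_mem a hf
    | add p q hp hq =>
      intro f hf
      rw [map_add, add_mul]; exact add_mem (hp f hf) (hq f hf)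
    | mul_X p s hp =>
      intro f hf
      rw [map_mul, MvPolynomial.aeval_X, mul_assoc]
      apply hp
      fin_cases s
      · exact hx f hf
      · convert hy f hf using 2
        change (X ^ 8 + X ^ (w + 8) : ℂ⟦X⟧) = _
        ring
  rw [← sub_add_cancel r (MvPolynomial.aeval (generators (w + 8)) p), add_mul]
  exact add_mem (hN (Dvd.dvd.mul_right hp f)) (key p f hf)

/-! ### Monic series and triangular spans -/

theorem isMonicOfOrder_iff {f : ℂ⟦X⟧} {n : ℕ} :
    IsMonicOfOrder f n ↔ coeff n f = 1 ∧ ∀ i < n, coeff i f = 0 := by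
  rw [IsMonicOfOrder, order_eq_nat]
  constructor
  · rintro ⟨⟨-, h⟩, h1⟩; exact ⟨h1, h⟩
  · rintro ⟨h1, h⟩; exact ⟨⟨by rw [h1]; exact one_ne_zero, h⟩, h1⟩

theorem isMonicOfOrder_X_pow_mul (n : ℕ) {u : ℂ⟦X⟧} (hu : constantCoeff u = 1) :
    IsMonicOfOrder (X ^ n * u) n := by
  rw [isMonicOfOrder_iff]
  constructor
  · rw [coeff_X_pow_mul', if_pos le_rfl, Nat.sub_self, coeff_zero_eq_constantCoeff_apply, hu]
  · intro i hi
    rw [coeff_X_pow_mul', if_neg (by omega)]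

theorem IsMonicOfOrder.exists_eq {f : ℂ⟦X⟧} {n : ℕ} (hf : IsMonicOfOrder f n) :
    ∃ u : ℂ⟦X⟧, constantCoeff u = 1 ∧ f = X ^ n * u := by
  obtain ⟨h1, h0⟩ := isMonicOfOrder_iff.mp hf
  obtain ⟨u, rfl⟩ := X_pow_dvd_iff.mpr h0
  refine ⟨u, ?_, rfl⟩
  rwa [coeff_X_pow_mul', if_pos le_rfl, Nat.sub_self, coeff_zero_eq_constantCoeff_apply] at h1

theorem IsMonicOfOrder.mul {f g : ℂ⟦X⟧} {m n : ℕ} (hf : IsMonicOfOrder f m)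
    (hg : IsMonicOfOrder g n) : IsMonicOfOrder (f * g) (m + n) := by
  obtain ⟨u, hu, rfl⟩ := hf.exists_eq
  obtain ⟨u', hu', rfl⟩ := hg.exists_eq
  rw [show X ^ m * u * (X ^ n * u') = X ^ (m + n) * (u * u') by ring]
  exact isMonicOfOrder_X_pow_mul _ (by rw [map_mul, hu, hu', one_mul])

theorem constantCoeff_hUnit_pow {w : ℕ} (hw : w ≠ 0) (b : ℕ) :
    constantCoeff (hUnit w ^ b) = 1 := by
  simp [hw]

theorem isMonicOfOrder_genMonomial {w : ℕ} (hw : w ≠ 0) (a b : ℕ) :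
    IsMonicOfOrder (genMonomial w a b) (6 * a + 8 * b) :=
  isMonicOfOrder_X_pow_mul _ (constantCoeff_hUnit_pow hw b)

/-- The span of a family of power series indexed by a set of exponents, together with all series
of order at least `N`. -/
noncomputable def triSpan (m : ℕ → ℂ⟦X⟧) (D : Set ℕ) (N : ℕ) : Submodule ℂ ℂ⟦X⟧ :=
  Submodule.span ℂ (m '' D) ⊔ tail N

theorem mem_triSpan_of_mem {m : ℕ → ℂ⟦X⟧} {D : Set ℕ} (N : ℕ) {n : ℕ} (hn : n ∈ D) :
    m n ∈ triSpan m D N :=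
  Submodule.mem_sup_left (Submodule.subset_span ⟨n, hn, rfl⟩)

theorem tail_le_triSpan (m : ℕ → ℂ⟦X⟧) (D : Set ℕ) (N : ℕ) : tail N ≤ triSpan m D N := le_sup_right

theorem triSpan_le {m : ℕ → ℂ⟦X⟧} {D : Set ℕ} {N : ℕ} {W : Submodule ℂ ℂ⟦X⟧}
    (hm : ∀ n ∈ D, m n ∈ W) (hN : tail N ≤ W) : triSpan m D N ≤ W :=
  sup_le (Submodule.span_le.mpr (by rintro _ ⟨n, hn, rfl⟩; exact hm n hn)) hN

theorem triSpan_mono {m : ℕ → ℂ⟦X⟧} {D D' : Set ℕ} (N : ℕ) (h : D ⊆ D') :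
    triSpan m D N ≤ triSpan m D' N :=
  triSpan_le (fun _ hn => mem_triSpan_of_mem N (h hn)) (tail_le_triSpan _ _ _)

theorem coeff_eq_zero_of_mem_triSpan {m : ℕ → ℂ⟦X⟧} {D : Set ℕ} {N k : ℕ} (hk : k < N)
    (hm : ∀ n ∈ D, coeff k (m n) = 0) {f : ℂ⟦X⟧} (hf : f ∈ triSpan m D N) : coeff k f = 0 := by
  have : triSpan m D N ≤ LinearMap.ker (coeff (R := ℂ) k) :=
    triSpan_le (fun n hn => hm n hn) fun g hg => X_pow_dvd_iff.mp hg k hk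
  exact this hf

theorem mem_triSpan_insert {m : ℕ → ℂ⟦X⟧} {D : Set ℕ} {N i : ℕ} {f : ℂ⟦X⟧}
    (hf : f ∈ triSpan m (insert i D) N) : ∃ c : ℂ, f - c • m i ∈ triSpan m D N := by
  rw [triSpan, Set.image_insert_eq] at hf
  obtain ⟨g, hg, t, ht, rfl⟩ := Submodule.mem_sup.mp hf
  obtain ⟨c, z, hz, rfl⟩ := Submodule.mem_span_insert.mp hg
  refine ⟨c, ?_⟩
  rw [show c • m i + z + t - c • m i = z + t by abel]
  exact add_mem (Submodule.mem_sup_left hz) (Submodule.mem_sup_right ht)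

/-- Triangularity: among the `m n` with `n ≥ i` only `m i` has a nonzero coefficient at `i`. This is
one elimination step; iterated, it identifies the orders occurring in the span. -/
theorem mem_triSpan_succ {m : ℕ → ℂ⟦X⟧} (hm : ∀ n, IsMonicOfOrder (m n) n) {D : Set ℕ} {N i : ℕ}
    (hi : i < N) {f : ℂ⟦X⟧} (hf : f ∈ triSpan m (D ∩ Set.Ici i) N) :
    f - coeff i f • m i ∈ triSpan m (D ∩ Set.Ici (i + 1)) N ∧ (coeff i f ≠ 0 → i ∈ D) := by
  have hlow : ∀ g ∈ triSpan m (D ∩ Set.Ici (i + 1)) N, coeff i g = 0 := fun g hg =>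
    coeff_eq_zero_of_mem_triSpan hi
      (fun n hn => (isMonicOfOrder_iff.mp (hm n)).2 i hn.2) hg
  by_cases hD : i ∈ D
  · refine ⟨?_, fun _ => hD⟩
    have hsub : D ∩ Set.Ici i ⊆ insert i (D ∩ Set.Ici (i + 1)) := by
      rintro n ⟨hn, hni⟩
      rcases (Set.mem_Ici.mp hni).eq_or_lt with rfl | h
      · exact Set.mem_insert _ _
      · exact Set.mem_insert_of_mem _ ⟨hn, h⟩
    obtain ⟨c, hc⟩ := mem_triSpan_insert (triSpan_mono N hsub hf)
    have h0 := hlow _ hc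
    rw [map_sub, coeff_smul, (isMonicOfOrder_iff.mp (hm i)).1, smul_eq_mul, mul_one,
      sub_eq_zero] at h0
    rwa [h0]
  · have hsub : D ∩ Set.Ici i ⊆ D ∩ Set.Ici (i + 1) := by
      rintro n ⟨hn, hni⟩
      rcases (Set.mem_Ici.mp hni).eq_or_lt with rfl | h
      · exact absurd hn hD
      · exact ⟨hn, h⟩
    have h1 := triSpan_mono N hsub hf
    have h0 := hlow _ h1
    rw [h0, zero_smul, sub_zero]
    exact ⟨h1, fun h => absurd rfl h⟩

theorem mem_triSpan_Ici {m : ℕ → ℂ⟦X⟧} (hm : ∀ n, IsMonicOfOrder (m n) n) {D : Set ℕ} {N : ℕ}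
    {f : ℂ⟦X⟧} (hf : f ∈ triSpan m D N) {i : ℕ} (hi : i ≤ N) (h0 : ∀ k < i, coeff k f = 0) :
    f ∈ triSpan m (D ∩ Set.Ici i) N := by
  induction i with
  | zero =>
    have hsub : D ⊆ D ∩ Set.Ici 0 := fun n hn => ⟨hn, Nat.zero_le n⟩
    exact triSpan_mono N hsub hf
  | succ i ih =>
    have h1 := (mem_triSpan_succ hm hi (ih (by omega) fun k hk => h0 k (by omega))).1
    rwa [h0 i (by omega), zero_smul, sub_zero] at h1

theorem order_mem_of_mem_triSpan {m : ℕ → ℂ⟦X⟧} (hm : ∀ n, IsMonicOfOrder (m n) n) {D : Set ℕ}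
    {N : ℕ} (hD : ∀ n, N ≤ n → n ∈ D) {f : ℂ⟦X⟧} (hf : f ∈ triSpan m D N) {i : ℕ}
    (hi : f.order = i) : i ∈ D := by
  obtain ⟨h1, h0⟩ := order_eq_nat.mp hi
  rcases lt_or_ge i N with h | h
  · exact (mem_triSpan_succ hm h (mem_triSpan_Ici hm hf h.le h0)).2 h1
  · exact hD i h

theorem mul_mem_triSpan {m : ℕ → ℂ⟦X⟧} {D : Set ℕ} {N : ℕ} {g : ℂ⟦X⟧}
    (hg : ∀ n ∈ D, g * m n ∈ triSpan m D N) {f : ℂ⟦X⟧} (hf : f ∈ triSpan m D N) :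
    g * f ∈ triSpan m D N := by
  have : triSpan m D N ≤ (triSpan m D N).comap (LinearMap.mulLeft ℂ g) :=
    triSpan_le hg fun t ht => tail_le_triSpan _ _ _ (Dvd.dvd.mul_left ht g)
  exact this hf

theorem isAdmissible_of_triSpan {w : ℕ} (hv : 9 ≤ w + 8) {m : ℕ → ℂ⟦X⟧}
    (hm : ∀ n, IsMonicOfOrder (m n) n) {D : Set ℕ} {N : ℕ} (hD : ∀ n, N ≤ n → n ∈ D)
    (hx : ∀ n ∈ D, X ^ 6 * m n ∈ triSpan m D N)
    (hy : ∀ n ∈ D, X ^ 8 * hUnit w * m n ∈ triSpan m D N) : IsAdmissible (w + 8) hv D := by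
  refine ⟨{ (triSpan m D N).toAddSubmonoid with
    smul_mem' := fun r f hf => ?_ }, ?_⟩
  · exact ringR_mul_mem (tail_le_triSpan _ _ _) (fun _ => mul_mem_triSpan hx)
      (fun _ => mul_mem_triSpan hy) r.2 hf
  · ext n
    constructor
    · rintro ⟨f, hf, hn⟩
      exact order_mem_of_mem_triSpan hm hD hf hn
    · intro hn
      exact ⟨m n, mem_triSpan_of_mem N hn, (hm n).1⟩

/-! ### Odd coefficients of ring elements -/

/-- The even elements of the semigroup: the semigroup generated by `6` and `8`. -/
def evenSemigroup : Set ℕ := {n | ∃ a b, b ≤ 2 ∧ n = 6 * a + 8 * b}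

theorem mem_evenSemigroup {n : ℕ} (h : Even n) (h2 : n ≠ 2) (h4 : n ≠ 4) (h10 : n ≠ 10) :
    n ∈ evenSemigroup := by
  obtain ⟨k, rfl⟩ := h
  exact ⟨(k - 4 * (k % 3)) / 3, k % 3, by omega, by omega⟩

/-- The monomial in the generators of even order `e`, for `e` in the semigroup. -/
noncomputable abbrev evenMonomial (w e : ℕ) : ℂ⟦X⟧ := X ^ e * hUnit w ^ (e / 2 % 3)

theorem isMonicOfOrder_evenMonomial {w : ℕ} (hw : w ≠ 0) (e : ℕ) :
    IsMonicOfOrder (evenMonomial w e) e :=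
  isMonicOfOrder_X_pow_mul _ (constantCoeff_hUnit_pow hw _)

/-- The only product leaving the list of monomials with `b ≤ 2` is `y^3`, which may be replaced by
`x^4` because `t^24 (h^3 - 1)` is divisible by `t^(24 + w)`. -/
theorem ringR_le_triSpan {w : ℕ} (hv : 9 ≤ w + 8) {r : ℂ⟦X⟧} (hr : r ∈ ringR (w + 8) hv) :
    r ∈ triSpan (evenMonomial w) evenSemigroup (24 + w) := by
  have h1 : (1 : ℂ⟦X⟧) ∈ triSpan (evenMonomial w) evenSemigroup (24 + w) := by
    have : (0 : ℕ) ∈ evenSemigroup := ⟨0, 0, by norm_num, rfl⟩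
    simpa [evenMonomial] using mem_triSpan_of_mem (m := evenMonomial w) (24 + w) this
  rw [← mul_one r]
  refine ringR_mul_mem (tail_le_triSpan _ _ _) (fun _ => mul_mem_triSpan ?_)
    (fun _ => mul_mem_triSpan ?_) hr h1
  · rintro n ⟨a, b, hb, rfl⟩
    have hmem : 6 * a + 8 * b + 6 ∈ evenSemigroup := ⟨a + 1, b, hb, by ring⟩
    convert mem_triSpan_of_mem (m := evenMonomial w) (24 + w) hmem using 1
    rw [evenMonomial, evenMonomial,
      show (6 * a + 8 * b + 6) / 2 % 3 = (6 * a + 8 * b) / 2 % 3 by omega]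
    ring
  · rintro n ⟨a, b, hb, rfl⟩
    rcases hb.lt_or_eq with hb | rfl
    · have hmem : 6 * a + 8 * b + 8 ∈ evenSemigroup := ⟨a, b + 1, by omega, by ring⟩
      convert mem_triSpan_of_mem (m := evenMonomial w) (24 + w) hmem using 1
      rw [evenMonomial, evenMonomial,
        show (6 * a + 8 * b + 8) / 2 % 3 = (6 * a + 8 * b) / 2 % 3 + 1 by omega]
      ring
    · have hmem : 6 * a + 24 ∈ evenSemigroup := ⟨a + 4, 0, by omega, by ring⟩
      rw [← sub_add_cancel (X ^ 8 * hUnit w * evenMonomial w (6 * a + 8 * 2))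
        (evenMonomial w (6 * a + 24))]
      refine add_mem (tail_le_triSpan _ _ _ ?_) (mem_triSpan_of_mem _ hmem)
      rw [evenMonomial, evenMonomial, show (6 * a + 24) / 2 % 3 = 0 by omega,
        show (6 * a + 8 * 2) / 2 % 3 = 2 by omega]
      refine ⟨X ^ (6 * a) * (3 + 3 * X ^ w + X ^ (2 * w)), ?_⟩
      ring

theorem even_mem_of_mem_semigroupΓ {w : ℕ} (hv : 9 ≤ w + 8) {i : ℕ}
    (hi : i ∈ semigroupΓ (w + 8) hv) (hlt : i < 24 + w) : i ∈ evenSemigroup := by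
  obtain ⟨f, hf, hfi⟩ := hi
  obtain ⟨h1, h0⟩ := order_eq_nat.mp hfi
  have hm := isMonicOfOrder_evenMonomial (w := w) (by omega)
  exact (mem_triSpan_succ hm hlt (mem_triSpan_Ici hm (ringR_le_triSpan hv hf) hlt.le h0)).2 h1

/-- For `b ≤ 2` the only possible exponents in `h^b` are 0, `w`, `2w`; of these only `w` has the
parity of an odd number, with coefficient `b`. -/
theorem coeff_evenMonomial_of_odd {w : ℕ} {e k : ℕ} (he : Even e) (hk : Odd k) :
    coeff k (evenMonomial w e) = if k = e + w then ((e / 2 % 3 : ℕ) : ℂ) else 0 := by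
  have hb : e / 2 % 3 < 3 := Nat.mod_lt _ (by norm_num)
  rw [evenMonomial]
  generalize e / 2 % 3 = b at hb
  have hke : k ≠ e := by rintro rfl; exact (Nat.not_even_iff_odd.mpr hk) he
  have hk2 : k ≠ e + 2 * w := by
    rintro rfl; exact (Nat.not_even_iff_odd.mpr hk) (he.add (even_two_mul w))
  interval_cases b
  · simp [coeff_X_pow, hke]
  · rw [show X ^ e * hUnit w ^ 1 = (X ^ e + X ^ (e + w) : ℂ⟦X⟧) by ring]
    simp [coeff_X_pow, hke]
  · rw [show X ^ e * hUnit w ^ 2 = (X ^ e + (2 : ℂ) • X ^ (e + w) + X ^ (e + 2 * w) : ℂ⟦X⟧) by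
      rw [smul_eq_C_mul, map_ofNat]; ring]
    simp [coeff_X_pow, hke, hk2]

/-- Once the leading monomial is removed, what remains is spanned by monomials of larger even order,
whose odd terms lie beyond `i + w`. The bound `i < 24` keeps `i + w` inside the range where the ring
is spanned by these monomials. -/
theorem coeff_odd_of_mem_ringR {w : ℕ} {hv : 9 ≤ w + 8} {φ : ℂ⟦X⟧} {i : ℕ}
    (hφ : φ ∈ ringR (w + 8) hv) (hi : IsMonicOfOrder φ i) (hev : Even i) (hlt : i < 24) {k : ℕ}
    (hk : Odd k) (hki : k ≤ i + w) :
    coeff k φ = if k = i + w then ((i / 2 % 3 : ℕ) : ℂ) else 0 := by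
  have hm := isMonicOfOrder_evenMonomial (w := w) (by omega)
  obtain ⟨h1, h0⟩ := isMonicOfOrder_iff.mp hi
  have h2 := (mem_triSpan_succ hm (by omega)
    (mem_triSpan_Ici hm (ringR_le_triSpan hv hφ) (by omega) h0)).1
  rw [h1, one_smul] at h2
  have h3 : coeff k (φ - evenMonomial w i) = 0 := by
    refine coeff_eq_zero_of_mem_triSpan (by omega) ?_ h2
    rintro n ⟨⟨a, b, -, rfl⟩, hn⟩
    rw [coeff_evenMonomial_of_odd ⟨3 * a + 4 * b, by ring⟩ hk, if_neg]
    have := Set.mem_Ici.mp hn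
    omega
  rw [map_sub, sub_eq_zero, coeff_evenMonomial_of_odd hev hk] at h3
  exact h3

/-! ### The leading odd term of a unit -/

/-- The odd part of the unit `u` starts with `c t^w`, up to order `w`. -/
def HasOddTerm (w : ℕ) (u : ℂ⟦X⟧) (c : ℂ) : Prop :=
  X ^ (w + 1) ∣ u - rescale (-1) u - C (2 * c) * X ^ w

theorem X_dvd_sub_one {u : ℂ⟦X⟧} (hu : constantCoeff u = 1) : X ∣ u - 1 := by
  rw [X_dvd_iff, map_sub, hu, map_one, sub_self]

theorem X_dvd_rescale_sub_one {u : ℂ⟦X⟧} (hu : constantCoeff u = 1) :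
    X ∣ rescale (-1) u - 1 := by
  rw [X_dvd_iff, map_sub, map_one, ← coeff_zero_eq_constantCoeff_apply, coeff_rescale, pow_zero,
    one_mul, coeff_zero_eq_constantCoeff_apply, hu, sub_self]

/-- Both units are 1 modulo `t`, so multiplying an odd part starting at `t^w` by the other unit
leaves its first coefficient unchanged, and the coefficients add. -/
theorem HasOddTerm.mul {w : ℕ} {u u' : ℂ⟦X⟧} {c d : ℂ} (hu : constantCoeff u = 1)
    (hu' : constantCoeff u' = 1) (h : HasOddTerm w u c) (h' : HasOddTerm w u' d) :
    HasOddTerm w (u * u') (c + d) := by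
  have e : u * u' - rescale (-1) (u * u') - C (2 * (c + d)) * X ^ w =
      (u - rescale (-1) u - C (2 * c) * X ^ w) * u' +
      (u' - rescale (-1) u' - C (2 * d) * X ^ w) * rescale (-1) u +
      X ^ w * (u' - 1) * C (2 * c) + X ^ w * (rescale (-1) u - 1) * C (2 * d) := by
    simp only [map_mul, map_add]; ring
  rw [HasOddTerm, e]
  exact dvd_add (dvd_add (dvd_add (h.mul_right _) (h'.mul_right _))
    (Dvd.dvd.mul_right (pow_succ (X : ℂ⟦X⟧) w ▸ mul_dvd_mul_left _ (X_dvd_sub_one hu')) _))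
    (Dvd.dvd.mul_right (pow_succ (X : ℂ⟦X⟧) w ▸ mul_dvd_mul_left _ (X_dvd_rescale_sub_one hu)) _)

theorem HasOddTerm.of_mul {w : ℕ} {u u' : ℂ⟦X⟧} {c d : ℂ} (hu : constantCoeff u = 1)
    (hu' : constantCoeff u' = 1) (h : HasOddTerm w u c) (h' : HasOddTerm w (u * u') d) :
    HasOddTerm w u' (d - c) := by
  have e : rescale (-1) u * (u' - rescale (-1) u' - C (2 * (d - c)) * X ^ w) =
      (u * u' - rescale (-1) (u * u') - C (2 * d) * X ^ w) -
      (u - rescale (-1) u - C (2 * c) * X ^ w) * u' -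
      X ^ w * (u' - 1) * C (2 * c) - X ^ w * (rescale (-1) u - 1) * C (2 * (d - c)) := by
    simp only [map_mul, map_sub]; ring
  have hunit : IsUnit (rescale (-1) u) := by
    rw [isUnit_iff_constantCoeff]
    have := X_dvd_iff.mp (X_dvd_rescale_sub_one hu)
    rw [map_sub, map_one, sub_eq_zero] at this
    rw [this]; exact isUnit_one
  rw [HasOddTerm, ← hunit.dvd_mul_left, e]
  exact dvd_sub (dvd_sub (dvd_sub h' (h.mul_right _))
    (Dvd.dvd.mul_right (pow_succ (X : ℂ⟦X⟧) w ▸ mul_dvd_mul_left _ (X_dvd_sub_one hu')) _))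
    (Dvd.dvd.mul_right (pow_succ (X : ℂ⟦X⟧) w ▸ mul_dvd_mul_left _ (X_dvd_rescale_sub_one hu)) _)

theorem coeff_rescale_congr {N : ℕ} {f : ℂ⟦X⟧} (h : X ^ N ∣ f) : X ^ N ∣ rescale (-1) f := by
  rw [X_pow_dvd_iff] at h ⊢
  intro k hk
  rw [coeff_rescale, h k hk, mul_zero]

theorem HasOddTerm.congr {w : ℕ} {u u' : ℂ⟦X⟧} {c : ℂ} (h : HasOddTerm w u c)
    (hc : X ^ (w + 1) ∣ u' - u) : HasOddTerm w u' c := by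
  have e : u' - rescale (-1) u' - C (2 * c) * X ^ w =
      (u - rescale (-1) u - C (2 * c) * X ^ w) + (u' - u) - rescale (-1) (u' - u) := by
    simp only [map_sub]; ring
  rw [HasOddTerm, e]
  exact dvd_sub (dvd_add h hc) (coeff_rescale_congr hc)

theorem HasOddTerm.unique {w : ℕ} {u : ℂ⟦X⟧} {c d : ℂ} (h : HasOddTerm w u c)
    (h' : HasOddTerm w u d) : c = d := by
  have h1 := X_pow_dvd_iff.mp (dvd_sub h h') w (Nat.lt_succ_self w)
  simp only [map_sub, coeff_C_mul, coeff_X_pow, if_pos] at h1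
  linear_combination -h1 / 2

theorem hasOddTerm_of_mem_ringR {w : ℕ} {hv : 9 ≤ w + 8} (hw : Odd w) {u : ℂ⟦X⟧} {i : ℕ}
    (hu : constantCoeff u = 1) (hφ : X ^ i * u ∈ ringR (w + 8) hv) (hev : Even i) (hlt : i < 24) :
    HasOddTerm w u ((i / 2 % 3 : ℕ) : ℂ) := by
  rw [HasOddTerm, X_pow_dvd_iff]
  intro k hk
  have hc : coeff k u = coeff (i + k) (X ^ i * u) := by
    rw [coeff_X_pow_mul', if_pos (by omega), Nat.add_sub_cancel_left]
  rw [map_sub, map_sub, coeff_rescale, coeff_C_mul, coeff_X_pow]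
  rcases Nat.even_or_odd k with h | h
  · rw [h.neg_one_pow, if_neg (by rintro rfl; exact (Nat.not_even_iff_odd.mpr hw) h)]
    ring
  · rw [h.neg_one_pow, hc, coeff_odd_of_mem_ringR hφ (isMonicOfOrder_X_pow_mul i hu) hev hlt
      (hev.add_odd h) (by omega)]
    by_cases hkw : k = w
    · rw [if_pos (by omega), if_pos hkw]; ring
    · rw [if_neg (by omega), if_neg hkw]; ring

/-- A relation determines the leading odd term of the quotient of the two generators. -/
theorem Compatible.hasOddTerm {w : ℕ} {hv : 9 ≤ w + 8} (hw : Odd w) {Δ : Set ℕ} {p q : ℕ}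
    {u u' : ℂ⟦X⟧} (hu : constantCoeff u = 1) (hu' : constantCoeff u' = 1)
    (hc : Compatible (w + 8) hv Δ p q (X ^ p * u) (X ^ q * u')) {i j : ℕ}
    (hi : i ∈ evenSemigroup) (hj : j ∈ evenSemigroup) (hi24 : i < 24) (hj24 : j < 24)
    (hij : i + p = j + q) (hΔ : i + p + w ∉ Δ) :
    HasOddTerm w (u * u'⁻¹) (((j / 2 % 3 : ℕ) : ℂ) - ((i / 2 % 3 : ℕ) : ℂ)) := by
  have hw0 : w ≠ 0 := by omega
  have hΓ : ∀ n ∈ evenSemigroup, n ∈ semigroupΓ (w + 8) hv := by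
    rintro _ ⟨a, b, -, rfl⟩
    exact ⟨_, genMonomial_mem_ringR hv a b, (isMonicOfOrder_genMonomial hw0 a b).1⟩
  have hev : ∀ n ∈ evenSemigroup, Even n := by
    rintro _ ⟨a, b, -, rfl⟩; exact ⟨3 * a + 4 * b, by ring⟩
  obtain ⟨φ, hφ, ψ, hψ, hφi, hψj, hord⟩ :=
    hc i (hΓ i hi) j (hΓ j hj) hij (by rwa [Nat.add_sub_cancel])
  rw [Nat.add_sub_cancel] at hord
  obtain ⟨a, ha, rfl⟩ := hφi.exists_eq
  obtain ⟨b, hb, rfl⟩ := hψj.exists_eq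
  have ha' := hasOddTerm_of_mem_ringR hw ha hφ (hev i hi) hi24
  have hb' := hasOddTerm_of_mem_ringR hw hb hψ (hev j hj) hj24
  have hdvd : (X : ℂ⟦X⟧) ^ (i + p + w + 1) ∣ X ^ (i + p) * (a * u - b * u') := by
    rw [X_pow_dvd_iff]
    intro k hk
    apply coeff_of_lt_order
    rw [show X ^ (i + p) * (a * u - b * u') = X ^ i * a * (X ^ p * u) - X ^ j * b * (X ^ q * u') by
      rw [mul_sub]; nth_rewrite 2 [hij]; ring]
    exact lt_of_le_of_lt (by exact_mod_cast Nat.lt_succ_iff.mp hk) hord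
  rw [show i + p + w + 1 = (i + p) + (w + 1) by ring, pow_add,
    mul_dvd_mul_iff_left (pow_ne_zero _ X_ne_zero)] at hdvd
  have hinv : u' * u'⁻¹ = 1 := PowerSeries.mul_inv_cancel u' (by rw [hu']; exact one_ne_zero)
  have hcu : constantCoeff (u * u'⁻¹) = 1 := by
    rw [map_mul, hu, one_mul, constantCoeff_inv, hu', inv_one]
  -- The relation says `a u ≡ b u'` modulo `t^(w+1)`, so `a (u / u')` has the odd term of `b`.
  refine ha'.of_mul ha hcu (hb'.congr ?_)
  rw [show a * (u * u'⁻¹) - b = (a * u - b * u') * u'⁻¹ by linear_combination b * hinv]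
  exact hdvd.mul_right _

/-! ### Conflicting relations -/

/-- The combinatorial description of the obstructed modules. -/
def IsBad (w : ℕ) (Δ : Set ℕ) : Prop :=
  (10 ∈ Δ ∧ 2 ∉ Δ ∧ 4 ∉ Δ ∧ w + 16 ∉ Δ ∧ w + 18 ∉ Δ) ∨
  (2 ∈ Δ ∧ 4 ∉ Δ ∧ w + 8 ∉ Δ ∧ w + 18 ∉ Δ) ∨
  (2 ∉ Δ ∧ 4 ∈ Δ ∧ w + 12 ∉ Δ ∧ w + 16 ∉ Δ) ∨
  (2 ∈ Δ ∧ 4 ∈ Δ ∧ w + 8 ∉ Δ ∧ w + 10 ∉ Δ ∧ w + 12 ∉ Δ)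

/-- Two incompatible relations for the same pair. -/
theorem pairObstructed_of_relations {w : ℕ} {hv : 9 ≤ w + 8} (hw : Odd w) {Δ : Set ℕ} {p q : ℕ}
    (hp : p ∈ Δ) (hq : q ∈ Δ) {i j i' j' : ℕ} (hi : i ∈ evenSemigroup) (hj : j ∈ evenSemigroup)
    (hi' : i' ∈ evenSemigroup) (hj' : j' ∈ evenSemigroup) (h24 : i < 24 ∧ j < 24)
    (h24' : i' < 24 ∧ j' < 24) (hij : i + p = j + q) (hij' : i' + p = j' + q)
    (hΔ : i + p + w ∉ Δ) (hΔ' : i' + p + w ∉ Δ)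
    (hne : j / 2 % 3 + i' / 2 % 3 ≠ j' / 2 % 3 + i / 2 % 3) :
    PairObstructed (w + 8) hv Δ p q := by
  refine ⟨hp, hq, ?_⟩
  rintro ⟨mp, mq, hmp, hmq, hc⟩
  obtain ⟨u, hu, rfl⟩ := hmp.exists_eq
  obtain ⟨u', hu', rfl⟩ := hmq.exists_eq
  have h1 := (hc.hasOddTerm hw hu hu' hi hj h24.1 h24.2 hij hΔ).unique
    (hc.hasOddTerm hw hu hu' hi' hj' h24'.1 h24'.2 hij' hΔ')
  apply hne
  have h2 : ((j / 2 % 3 : ℕ) : ℂ) + ((i' / 2 % 3 : ℕ) : ℂ) =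
      ((j' / 2 % 3 : ℕ) : ℂ) + ((i / 2 % 3 : ℕ) : ℂ) := by linear_combination h1
  exact_mod_cast h2

theorem obstructed_of_isBad {w : ℕ} {hv : 9 ≤ w + 8} (hw : Odd w) {Δ : Set ℕ} (h0 : 0 ∈ Δ)
    (hbad : IsBad w Δ) :
    (∃ p ∈ ({2, 4, 10} : Set ℕ), PairObstructed (w + 8) hv Δ p 0) ∨
      PairObstructed (w + 8) hv Δ 4 2 ∨ TripleObstructed (w + 8) hv Δ := by
  have hS : ∀ n, Even n → n ≠ 2 → n ≠ 4 → n ≠ 10 → n ∈ evenSemigroup := fun n =>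
    mem_evenSemigroup
  rcases hbad with ⟨h10, -, -, h16, h18⟩ | ⟨h2, -, h8, h18⟩ | ⟨-, h4, h12, h16⟩ |
    ⟨h2, h4, h8, h10, h12⟩
  -- The two relations require the odd term of `m_10 / m_0` to be 2 (at `w + 16`) and -1 (at `w +
  -- 18`).
  · refine Or.inl ⟨10, by simp, pairObstructed_of_relations hw h10 h0 (i := 6) (j := 16) (i' := 8)
      (j' := 18) ?_ ?_ ?_ ?_ ?_ ?_ ?_ ?_ ?_ ?_ ?_⟩
    any_goals first | (apply hS <;> decide) | decide
    · rwa [add_comm]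
    · rwa [add_comm]
  -- Here the required odd terms of `m_2 / m_0` are 1 (at `w + 8`) and -2 (at `w + 18`).
  · refine Or.inl ⟨2, by simp, pairObstructed_of_relations hw h2 h0 (i := 6) (j := 8) (i' := 16)
      (j' := 18) ?_ ?_ ?_ ?_ ?_ ?_ ?_ ?_ ?_ ?_ ?_⟩
    any_goals first | (apply hS <;> decide) | decide
    · rwa [add_comm]
    · rwa [add_comm]
  -- Here the required odd terms of `m_4 / m_0` are -1 (at `w + 12`) and 2 (at `w + 16`).
  · refine Or.inl ⟨4, by simp, pairObstructed_of_relations hw h4 h0 (i := 8) (j := 12) (i' := 12)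
      (j' := 16) ?_ ?_ ?_ ?_ ?_ ?_ ?_ ?_ ?_ ?_ ?_⟩
    any_goals first | (apply hS <;> decide) | decide
    · rwa [add_comm]
    · rwa [add_comm]
  · refine Or.inr (Or.inr ⟨h0, h2, h4, ?_⟩)
    rintro ⟨m0, m2, m4, hm0, hm2, hm4, hc20, hc40, hc42⟩
    obtain ⟨u0, hu0, rfl⟩ := hm0.exists_eq
    obtain ⟨u2, hu2, rfl⟩ := hm2.exists_eq
    obtain ⟨u4, hu4, rfl⟩ := hm4.exists_eq
    -- The odd terms of `m_2 / m_0`, `m_4 / m_0`, `m_4 / m_2` are 1, -1, 1, whereas additivity would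
    -- need `1 + 1 = -1`.
    have t20 := hc20.hasOddTerm hw hu2 hu0 (i := 6) (j := 8) (by apply hS <;> decide)
      (by apply hS <;> decide) (by norm_num) (by norm_num) (by norm_num) (by rwa [add_comm])
    have t40 := hc40.hasOddTerm hw hu4 hu0 (i := 8) (j := 12) (by apply hS <;> decide)
      (by apply hS <;> decide) (by norm_num) (by norm_num) (by norm_num) (by rwa [add_comm])
    have t42 := hc42.hasOddTerm hw hu4 hu2 (i := 6) (j := 8) (by apply hS <;> decide)
      (by apply hS <;> decide) (by norm_num) (by norm_num) (by norm_num) (by rwa [add_comm])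
    have hcc : ∀ a b : ℂ⟦X⟧, constantCoeff a = 1 → constantCoeff b = 1 →
        constantCoeff (a * b⁻¹) = 1 := by
      intro a b ha hb
      rw [map_mul, ha, one_mul, constantCoeff_inv, hb, inv_one]
    have hinv : u2⁻¹ * u2 = 1 := PowerSeries.inv_mul_cancel u2 (by rw [hu2]; exact one_ne_zero)
    have hmul := (t42.mul (hcc _ _ hu4 hu2) (hcc _ _ hu2 hu0) t20)
    rw [show u4 * u2⁻¹ * (u2 * u0⁻¹) = u4 * u0⁻¹ by linear_combination (u4 * u0⁻¹) * hinv] at hmul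
    have := hmul.unique t40
    norm_num at this

/-! ### Stable sets of exponents and explicit solutions of the relations -/

/-- Sets of exponents containing `0` and stable under the generators `6`, `8`, `w + 24` of the
valuation semigroup. -/
structure IsPreModule (w : ℕ) (Δ : Set ℕ) : Prop where
  zero_mem : 0 ∈ Δ
  add_six : ∀ n ∈ Δ, n + 6 ∈ Δ
  add_eight : ∀ n ∈ Δ, n + 8 ∈ Δ
  add_gen : ∀ n ∈ Δ, n + (w + 24) ∈ Δ

theorem IsPreModule.add_mem {w : ℕ} {Δ : Set ℕ} (h : IsPreModule w Δ) {n : ℕ} (hn : n ∈ Δ)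
    {m : ℕ} (hm : m ∈ evenSemigroup) : n + m ∈ Δ := by
  obtain ⟨a, b, -, rfl⟩ := hm
  have h6 : ∀ a n, n ∈ Δ → n + 6 * a ∈ Δ := by
    intro a
    induction a with
    | zero => intro n hn; exact hn
    | succ a ih =>
      intro n hn
      have := ih _ (h.add_six n hn)
      rwa [show n + 6 + 6 * a = n + 6 * (a + 1) by ring] at this
  have h8 : ∀ b n, n ∈ Δ → n + 8 * b ∈ Δ := by
    intro b
    induction b with
    | zero => intro n hn; exact hn
    | succ a ih =>
      intro n hn
      have := ih _ (h.add_eight n hn)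
      rwa [show n + 8 + 8 * a = n + 8 * (a + 1) by ring] at this
  rw [← add_assoc]
  exact h8 b _ (h6 a n hn)

theorem IsPreModule.mem_of_sub {w : ℕ} {Δ : Set ℕ} (h : IsPreModule w Δ) {m n : ℕ} (hm : m ∈ Δ)
    (hle : m ≤ n) (hev : Even (n - m)) (h2 : n ≠ m + 2) (h4 : n ≠ m + 4) (h10 : n ≠ m + 10) :
    n ∈ Δ := by
  have := h.add_mem hm (mem_evenSemigroup hev (by omega) (by omega) (by omega))
  rwa [Nat.add_sub_cancel' hle] at this

theorem IsPreModule.even_mem {w : ℕ} {Δ : Set ℕ} (h : IsPreModule w Δ) {n : ℕ} (hn : Even n)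
    (h2 : n ≠ 2) (h4 : n ≠ 4) (h10 : n ≠ 10) : n ∈ Δ := by
  have := h.add_mem h.zero_mem (mem_evenSemigroup hn h2 h4 h10)
  rwa [zero_add] at this

theorem six_mem_semigroupΓ {w : ℕ} (hv : 9 ≤ w + 8) : 6 ∈ semigroupΓ (w + 8) hv :=
  ⟨X ^ 6, X_pow_six_mem_ringR hv, order_X_pow 6⟩

theorem eight_mem_semigroupΓ {w : ℕ} (hv : 9 ≤ w + 8) : 8 ∈ semigroupΓ (w + 8) hv := by
  refine ⟨_, X_pow_eight_mul_mem_ringR hv, (isMonicOfOrder_X_pow_mul 8 ?_).1⟩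
  simpa using constantCoeff_hUnit_pow (w := w) (by omega) 1

theorem add_twenty_four_mem_semigroupΓ {w : ℕ} (hv : 9 ≤ w + 8) :
    w + 24 ∈ semigroupΓ (w + 8) hv := by
  have hw : w ≠ 0 := by omega
  refine ⟨(1 / 3 : ℂ) • (genMonomial w 0 3 - genMonomial w 4 0),
    (ringR (w + 8) hv).smul_mem (sub_mem (genMonomial_mem_ringR hv 0 3)
      (genMonomial_mem_ringR hv 4 0)) _, ?_⟩
  have h3 : (C (1 / 3) : ℂ⟦X⟧) * 3 = 1 := by
    rw [show (3 : ℂ⟦X⟧) = C 3 by rw [map_ofNat], ← map_mul]; norm_num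
  have e : (1 / 3 : ℂ) • (genMonomial w 0 3 - genMonomial w 4 0) =
      X ^ (w + 24) * (1 + X ^ w + C (1 / 3) * X ^ (2 * w)) := by
    rw [smul_eq_C_mul, genMonomial, genMonomial]
    linear_combination (X ^ (24 + w) + X ^ (24 + 2 * w)) * h3
  rw [e]
  exact (isMonicOfOrder_X_pow_mul _ (by simp [hw])).1

theorem IsStandardModule.isPreModule {w : ℕ} {hv : 9 ≤ w + 8} {Δ : Set ℕ}
    (h : IsStandardModule (w + 8) hv Δ) : IsPreModule w Δ where
  zero_mem := h.1
  add_six n hn := by rw [add_comm]; exact h.2 _ (six_mem_semigroupΓ hv) n hn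
  add_eight n hn := by rw [add_comm]; exact h.2 _ (eight_mem_semigroupΓ hv) n hn
  add_gen n hn := by rw [add_comm]; exact h.2 _ (add_twenty_four_mem_semigroupΓ hv) n hn

/-- Units times monomials satisfy the relations as soon as the exponents of the units match. -/
theorem compatible_of_exponents {w : ℕ} {hv : 9 ≤ w + 8} (hw : Odd w) {Δ : Set ℕ}
    (hΔ : IsPreModule w Δ) {p q c d : ℕ} (hp : 2 ≤ p) (hpe : Even p) (hq : Even q)
    (H : ∀ a b a' b', b ≤ 2 → b' ≤ 2 → 6 * a + 8 * b + p = 6 * a' + 8 * b' + q →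
      w + (6 * a + 8 * b + p) ∉ Δ → b + c = b' + d) :
    Compatible (w + 8) hv Δ p q (X ^ p * hUnit w ^ c) (X ^ q * hUnit w ^ d) := by
  intro i hi j hj hij hn
  have hw0 : w ≠ 0 := by omega
  have hmem : ∀ n ∈ semigroupΓ (w + 8) hv, n ∈ evenSemigroup ∨ Odd n ∧ 24 + w ≤ n := by
    intro n hn
    rcases lt_or_ge n (24 + w) with h | h
    · exact Or.inl (even_mem_of_mem_semigroupΓ hv hn h)
    · rcases Nat.even_or_odd n with h' | h'
      · exact Or.inl (mem_evenSemigroup h' (by omega) (by omega) (by omega))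
      · exact Or.inr ⟨h', h⟩
  rw [Nat.add_sub_cancel] at hn ⊢
  obtain ⟨a, b, hb, rfl⟩ | ⟨ho, hle⟩ := hmem i hi
  · obtain ⟨a', b', hb', rfl⟩ | ⟨ho, hle⟩ := hmem j hj
    · refine ⟨_, genMonomial_mem_ringR hv a b, _, genMonomial_mem_ringR hv a' b',
        isMonicOfOrder_genMonomial hw0 a b, isMonicOfOrder_genMonomial hw0 a' b', ?_⟩
      have hbc := H a b a' b' hb hb' hij (by rwa [add_comm w])
      have : genMonomial w a b * (X ^ p * hUnit w ^ c) -
          genMonomial w a' b' * (X ^ q * hUnit w ^ d) = 0 := by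
        rw [genMonomial, genMonomial, sub_eq_zero,
          show X ^ (6 * a + 8 * b) * hUnit w ^ b * (X ^ p * hUnit w ^ c) =
            X ^ (6 * a + 8 * b + p) * hUnit w ^ (b + c) by ring, hij, hbc]
        ring
      rw [this, order_zero]
      exact ENat.natCast_lt_top _
    · obtain ⟨r, rfl⟩ := ho
      obtain ⟨s, rfl⟩ := hpe
      obtain ⟨t, rfl⟩ := hq
      omega
  -- An odd `i` is at least `24 + w`, so `i + p + w` is even and beyond all even gaps; no relation
  -- is imposed there.
  · exfalso
    apply hn
    have hev : Even (i + p + w) := (ho.add_even hpe).add_odd hw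
    exact hΔ.even_mem hev (by omega) (by omega) (by omega)

theorem not_pairObstructed_of_compatible {w : ℕ} {hv : 9 ≤ w + 8} {Δ : Set ℕ} {p q : ℕ} (c d : ℕ)
    (h : Compatible (w + 8) hv Δ p q (X ^ p * hUnit w ^ c) (X ^ q * hUnit w ^ d)) :
    ¬ PairObstructed (w + 8) hv Δ p q := by
  have hw : w ≠ 0 := by omega
  rintro ⟨-, -, hne⟩
  exact hne ⟨_, _, isMonicOfOrder_X_pow_mul p (constantCoeff_hUnit_pow hw c),
    isMonicOfOrder_X_pow_mul q (constantCoeff_hUnit_pow hw d), h⟩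

/-- The unit exponents are normalized to 2 at order 0, so that a quotient with odd term -2 or -1 is
still a nonnegative power of `h`. Each choice violates only relations located in `w + s` plus the
even semigroup, and these are not imposed once `w + s ∈ Δ`. -/
theorem IsPreModule.compatible {w : ℕ} {hv : 9 ≤ w + 8} (hw : Odd w) {Δ : Set ℕ}
    (hΔ : IsPreModule w Δ) :
    (w + 8 ∈ Δ → Compatible (w + 8) hv Δ 2 0 (X ^ 2 * hUnit w ^ 0) (X ^ 0 * hUnit w ^ 2)) ∧
    (w + 18 ∈ Δ → Compatible (w + 8) hv Δ 2 0 (X ^ 2 * hUnit w ^ 3) (X ^ 0 * hUnit w ^ 2)) ∧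
    (w + 12 ∈ Δ → Compatible (w + 8) hv Δ 4 0 (X ^ 4 * hUnit w ^ 4) (X ^ 0 * hUnit w ^ 2)) ∧
    (w + 16 ∈ Δ → Compatible (w + 8) hv Δ 4 0 (X ^ 4 * hUnit w ^ 1) (X ^ 0 * hUnit w ^ 2)) ∧
    (w + 16 ∈ Δ → Compatible (w + 8) hv Δ 10 0 (X ^ 10 * hUnit w ^ 1) (X ^ 0 * hUnit w ^ 2)) ∧
    (w + 18 ∈ Δ → Compatible (w + 8) hv Δ 10 0 (X ^ 10 * hUnit w ^ 4) (X ^ 0 * hUnit w ^ 2)) ∧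
    (w + 20 ∈ Δ → Compatible (w + 8) hv Δ 4 2 (X ^ 4 * hUnit w ^ 1) (X ^ 2 * hUnit w ^ 0)) ∧
    (w + 20 ∈ Δ → Compatible (w + 8) hv Δ 4 2 (X ^ 4 * hUnit w ^ 4) (X ^ 2 * hUnit w ^ 3)) ∧
    (w + 10 ∈ Δ → Compatible (w + 8) hv Δ 4 2 (X ^ 4 * hUnit w ^ 1) (X ^ 2 * hUnit w ^ 3)) := by
  have key : ∀ {s : ℕ}, w + s ∈ Δ → ∀ a b n, b ≤ 2 → n = w + s + (6 * a + 8 * b) → n ∈ Δ := by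
    rintro s hs a b n hb rfl
    exact hΔ.add_mem hs ⟨a, b, hb, rfl⟩
  refine ⟨?_, ?_, ?_, ?_, ?_, ?_, ?_, ?_, ?_⟩ <;> intro hs <;>
    refine compatible_of_exponents hw hΔ (by norm_num) (by decide) (by decide) ?_ <;>
    intro a b a' b' hb hb' he hn <;> by_contra hne <;> apply hn
  · exact key hs a' (b' - 1) _ (by omega) (by omega)
  · exact key hs a 0 _ (by omega) (by omega)
  · exact key hs a (b - 1) _ (by omega) (by omega)
  · exact key hs a' 0 _ (by omega) (by omega)
  · exact key hs a' 0 _ (by omega) (by omega)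
  · exact key hs a (b - 1) _ (by omega) (by omega)
  · exact key hs a 0 _ (by omega) (by omega)
  · exact key hs a 0 _ (by omega) (by omega)
  · exact key hs a' (b' - 1) _ (by omega) (by omega)

/-- Stability of the odd part of a module under the shifts by `6` and `8`, in the range that is
relevant for the relations. -/
theorem IsPreModule.odd_shifts {w : ℕ} {Δ : Set ℕ} (hΔ : IsPreModule w Δ) :
    (w + 8 ∈ Δ → w + 14 ∈ Δ ∧ w + 16 ∈ Δ ∧ w + 20 ∈ Δ) ∧
    (w + 10 ∈ Δ → w + 16 ∈ Δ ∧ w + 18 ∈ Δ) ∧ (w + 12 ∈ Δ → w + 18 ∈ Δ ∧ w + 20 ∈ Δ) ∧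
    (2 ∈ Δ → 10 ∈ Δ) ∧ (4 ∈ Δ → 10 ∈ Δ) :=
  ⟨fun h => ⟨hΔ.add_six _ h, hΔ.add_eight _ h, hΔ.add_six _ (hΔ.add_six _ h)⟩,
    fun h => ⟨hΔ.add_six _ h, hΔ.add_eight _ h⟩, fun h => ⟨hΔ.add_six _ h, hΔ.add_eight _ h⟩,
    hΔ.add_eight 2, hΔ.add_six 4⟩

/-- The clauses of `IsBad` separate cases according to which of 2, 4 lie in `Δ`. When both do, one
of `w + 8`, `w + 10`, `w + 12` is present, and its shifts by 6 and 8 supply the single-pair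
conditions. -/
theorem IsPreModule.relations_of_not_isBad {w : ℕ} {Δ : Set ℕ} (hΔ : IsPreModule w Δ)
    (h : ¬ IsBad w Δ) : (2 ∈ Δ → w + 8 ∈ Δ ∨ w + 18 ∈ Δ) ∧ (4 ∈ Δ → w + 12 ∈ Δ ∨ w + 16 ∈ Δ) ∧
    (10 ∈ Δ → w + 16 ∈ Δ ∨ w + 18 ∈ Δ) ∧
    (2 ∈ Δ → 4 ∈ Δ → w + 8 ∈ Δ ∨ w + 10 ∈ Δ ∨ w + 12 ∈ Δ) := by
  have hs := hΔ.odd_shifts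
  unfold IsBad at h
  grind

theorem IsPreModule.isBad_of_obstructed {w : ℕ} {hv : 9 ≤ w + 8} (hw : Odd w) {Δ : Set ℕ}
    (hΔ : IsPreModule w Δ)
    (hobs : (∃ p ∈ ({2, 4, 10} : Set ℕ), PairObstructed (w + 8) hv Δ p 0) ∨
      PairObstructed (w + 8) hv Δ 4 2 ∨ TripleObstructed (w + 8) hv Δ) : IsBad w Δ := by
  have hw0 : w ≠ 0 := by omega
  obtain ⟨c1, c2, c3, c4, c5, c6, c7, c8, c9⟩ := hΔ.compatible (hv := hv) hw
  obtain ⟨s8, s10, s12, -, -⟩ := hΔ.odd_shifts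
  by_contra hbad
  obtain ⟨r2, r4, r10, r24⟩ := hΔ.relations_of_not_isBad hbad
  have mon : ∀ n c, IsMonicOfOrder (X ^ n * hUnit w ^ c) n := fun n c =>
    isMonicOfOrder_X_pow_mul n (constantCoeff_hUnit_pow hw0 c)
  rcases hobs with ⟨p, hp, hobs⟩ | hobs | ⟨-, h2, h4, hobs⟩
  · have hpΔ := hobs.1
    rcases hp with rfl | rfl | rfl
    · rcases r2 hpΔ with h | h
      · exact not_pairObstructed_of_compatible _ _ (c1 h) hobs
      · exact not_pairObstructed_of_compatible _ _ (c2 h) hobs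
    · rcases r4 hpΔ with h | h
      · exact not_pairObstructed_of_compatible _ _ (c3 h) hobs
      · exact not_pairObstructed_of_compatible _ _ (c4 h) hobs
    · rcases r10 hpΔ with h | h
      · exact not_pairObstructed_of_compatible _ _ (c5 h) hobs
      · exact not_pairObstructed_of_compatible _ _ (c6 h) hobs
  · rcases r24 hobs.2.1 hobs.1 with h | h | h
    · exact not_pairObstructed_of_compatible _ _ (c7 (s8 h).2.2) hobs
    · exact not_pairObstructed_of_compatible _ _ (c9 h) hobs
    · exact not_pairObstructed_of_compatible _ _ (c7 (s12 h).2) hobs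
  · apply hobs
    rcases r24 h2 h4 with h | h | h
    · exact ⟨_, _, _, mon 0 2, mon 2 0, mon 4 1, c1 h, c4 (s8 h).2.1, c7 (s8 h).2.2⟩
    · exact ⟨_, _, _, mon 0 2, mon 2 3, mon 4 1, c2 (s10 h).2, c4 (s10 h).1, c9 h⟩
    · exact ⟨_, _, _, mon 0 2, mon 2 3, mon 4 4, c2 (s12 h).1, c3 h, c8 (s12 h).2⟩

/-! ### Bad modules are not admissible -/

theorem evenMonomial_eq_genMonomial (w a : ℕ) {b : ℕ} (hb : b ≤ 2) :
    evenMonomial w (6 * a + 8 * b) = genMonomial w a b := by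
  rw [evenMonomial, genMonomial, show (6 * a + 8 * b) / 2 % 3 = b by omega]

/-- A space of power series which contains `1`, is stable under the generators of the ring and
has set of valuations `Δ`. -/
structure IsNormalized (w : ℕ) (Δ : Set ℕ) (M : Submodule ℂ ℂ⟦X⟧) : Prop where
  evenMonomial_mem : ∀ n ∈ evenSemigroup, evenMonomial w n ∈ M
  mul_mem : ∀ a b, ∀ f ∈ M, genMonomial w a b * f ∈ M
  val_mem : ∀ f ∈ M, ∀ n, coeff n f ≠ 0 → (∀ k < n, coeff k f = 0) → n ∈ Δ
  exists_monic : ∀ n ∈ Δ, ∃ f ∈ M, IsMonicOfOrder f n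

/-- Dividing the module by one of its elements of order 0 changes no valuation and puts 1, hence the
ring monomials, into it. -/
theorem IsAdmissible.exists_isNormalized {w : ℕ} {hv : 9 ≤ w + 8} {Δ : Set ℕ}
    (h : IsAdmissible (w + 8) hv Δ) (h0 : 0 ∈ Δ) : ∃ M, IsNormalized w Δ M := by
  obtain ⟨M, rfl⟩ := h
  obtain ⟨u, hu, hu0⟩ := h0
  have hc : constantCoeff u ≠ 0 := by
    have := (order_eq_nat.mp hu0).1
    rwa [coeff_zero_eq_constantCoeff_apply] at this
  have hinv : u * u⁻¹ = 1 := PowerSeries.mul_inv_cancel u hc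
  have hmul : ∀ r ∈ ringR (w + 8) hv, ∀ f ∈ M, r * f ∈ M := fun r hr f hf =>
    M.smul_mem ⟨r, hr⟩ hf
  let M' : Submodule ℂ ℂ⟦X⟧ :=
    { carrier := {f | u * f ∈ M}
      add_mem' := fun {a b} ha hb => by
        change u * (a + b) ∈ M
        rw [mul_add]; exact add_mem ha hb
      zero_mem' := by change u * 0 ∈ M; rw [mul_zero]; exact zero_mem M
      smul_mem' := fun c f hf => by
        change u * (c • f) ∈ M
        rw [smul_eq_C_mul, show u * (C c * f) = C c * (u * f) by ring]
        exact hmul _ ((ringR (w + 8) hv).algebraMap_mem c) _ hf }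
  have hM' : ∀ f, f ∈ M' ↔ u * f ∈ M := fun f => Iff.rfl
  have hR : ∀ r ∈ ringR (w + 8) hv, ∀ f ∈ M', r * f ∈ M' := by
    intro r hr f hf
    rw [hM', show u * (r * f) = r * (u * f) by ring]
    exact hmul r hr _ hf
  have h1 : (1 : ℂ⟦X⟧) ∈ M' := by rwa [hM', mul_one]
  refine ⟨M', ⟨?_, fun a b f hf => hR _ (genMonomial_mem_ringR hv a b) f hf, ?_, ?_⟩⟩
  · rintro n ⟨a, b, hb, rfl⟩
    have := hR _ (genMonomial_mem_ringR hv a b) 1 h1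
    rwa [mul_one, ← evenMonomial_eq_genMonomial w a hb] at this
  · intro f hf n hn hlt
    refine ⟨u * f, hf, ?_⟩
    rw [order_mul, hu0, order_eq_nat.mpr ⟨hn, hlt⟩]
    simp
  · rintro n ⟨f, hf, hn⟩
    have ho : (u⁻¹ * f).order = n := by
      have : (u * (u⁻¹ * f)).order = n := by rw [← mul_assoc, hinv, one_mul, hn]
      rwa [order_mul, hu0, Nat.cast_zero, zero_add] at this
    obtain ⟨hne, hlt⟩ := order_eq_nat.mp ho
    have hmem : u⁻¹ * f ∈ M' := by rwa [hM', ← mul_assoc, hinv, one_mul]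
    refine ⟨(coeff n (u⁻¹ * f))⁻¹ • (u⁻¹ * f), M'.smul_mem _ hmem, isMonicOfOrder_iff.mpr ?_⟩
    refine ⟨by rw [coeff_smul, smul_eq_mul, inv_mul_cancel₀ hne], fun i hi => ?_⟩
    rw [coeff_smul, hlt i hi, smul_zero]

/-- Clearing the even coefficients of an element with elements of `M` without odd terms, the first
odd coefficient must vanish when its exponent is not in `Δ`. -/
theorem IsNormalized.coeff_eq_zero {w : ℕ} {Δ : Set ℕ} {M : Submodule ℂ ℂ⟦X⟧}
    (hM : IsNormalized w Δ M) {A n₀ : ℕ} (hn₀ : 5 ≤ n₀) (hA : A < n₀ + w) (hAΔ : A ∉ Δ)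
    (h10 : n₀ ≤ 10 → ∃ r ∈ M, IsMonicOfOrder r 10 ∧ ∀ k ≤ A, Odd k → coeff k r = 0)
    {f : ℂ⟦X⟧} (hf : f ∈ M) (hAo : Odd A) (h0 : ∀ k < A, k < n₀ ∨ Odd k → coeff k f = 0) :
    coeff A f = 0 := by
  have hw0 : w ≠ 0 ∨ A < n₀ := by omega
  have hr : ∀ n, Even n → n₀ ≤ n → n < A →
      ∃ r ∈ M, IsMonicOfOrder r n ∧ ∀ k ≤ A, Odd k → coeff k r = 0 := by
    intro n hev hn hnA
    rcases eq_or_ne n 10 with rfl | hne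
    · exact h10 hn
    -- The only possible odd term of this monomial sits at `n + w ≥ n₀ + w > A`. The gaps 2 and 4
    -- are excluded by `n₀ ≥ 5`; the gap 10 needs the separately supplied element.
    · refine ⟨evenMonomial w n, hM.evenMonomial_mem n
        (mem_evenSemigroup hev (by omega) (by omega) hne),
        isMonicOfOrder_evenMonomial (by omega) n, fun k hk hko => ?_⟩
      rw [coeff_evenMonomial_of_odd hev hko, if_neg (by omega)]
  have key : ∀ n ≤ A, ∃ g ∈ M, coeff A g = coeff A f ∧
      ∀ k < A, k < n₀ ∨ k < n ∨ Odd k → coeff k g = 0 := by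
    intro n
    induction n with
    | zero => exact fun _ => ⟨f, hf, rfl, fun k hk h => h0 k hk (by simpa using h)⟩
    | succ n ih =>
      intro hn
      obtain ⟨g, hg, hgA, hgz⟩ := ih (by omega)
      by_cases hc : n < n₀ ∨ Odd n
      · refine ⟨g, hg, hgA, fun k hk h => ?_⟩
        rcases eq_or_ne k n with rfl | hkn
        · exact hgz k hk (by tauto)
        · exact hgz k hk (by
            rcases h with h | h | h
            · exact Or.inl h
            · exact Or.inr (Or.inl (by omega))
            · exact Or.inr (Or.inr h))
      · push Not at hc
        obtain ⟨r, hr, hrm, hro⟩ := hr n (Nat.not_odd_iff_even.mp hc.2) hc.1 (by omega)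
        obtain ⟨hr1, hr0⟩ := isMonicOfOrder_iff.mp hrm
        refine ⟨g - coeff n g • r, sub_mem hg (M.smul_mem _ hr), ?_, fun k hk h => ?_⟩
        · rw [map_sub, coeff_smul, hro A le_rfl hAo, smul_zero, sub_zero, hgA]
        · rw [map_sub, coeff_smul]
          rcases eq_or_ne k n with rfl | hkn
          · rw [hr1, smul_eq_mul, mul_one, sub_self]
          · rcases lt_or_ge k n with hlt | hge
            · rw [hr0 k hlt, smul_zero, sub_zero]
              exact hgz k hk (by tauto)
            · have hko : Odd k := by
                rcases h with h | h | h
                · omega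
                · omega
                · exact h
              rw [hro k hk.le hko, smul_zero, sub_zero]
              exact hgz k hk (by tauto)
  obtain ⟨g, hg, hgA, hgz⟩ := key A le_rfl
  rw [← hgA]
  by_contra hne
  exact hAΔ (hM.val_mem g hg A hne fun k hk => hgz k hk (by tauto))

theorem coeff_shift_eq_zero {f : ℂ⟦X⟧} {p B : ℕ} (hf : ∀ k < p, coeff k f = 0)
    (hB : ∀ k < B, Odd k → coeff k f = 0) {s n : ℕ} (h : n < s + p ∨ n < s + B ∧ Odd n ∧ Even s) :
    coeff n (X ^ s * f) = 0 := by
  rw [coeff_X_pow_mul']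
  split_ifs with hs
  · rcases h with h | ⟨h, ho, he⟩
    · exact hf _ (by omega)
    · exact hB _ (by omega) (Nat.Odd.sub_even hs ho he)
  · rfl

theorem coeff_shift {f : ℂ⟦X⟧} {s n k : ℕ} (h : n = s + k) : coeff n (X ^ s * f) = coeff k f := by
  rw [h, coeff_X_pow_mul', if_pos (by omega), Nat.add_sub_cancel_left]

theorem genMonomial_zero_one_mul (w : ℕ) (f : ℂ⟦X⟧) :
    genMonomial w 0 1 * f = X ^ 8 * f + X ^ (8 + w) * f := by
  rw [genMonomial]; ring

theorem genMonomial_zero_two_mul (w : ℕ) (f : ℂ⟦X⟧) :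
    genMonomial w 0 2 * f = X ^ 16 * f + 2 * (X ^ (16 + w) * f) + X ^ (16 + 2 * w) * f := by
  rw [genMonomial]; ring

theorem coeff_two_mul (n : ℕ) (f : ℂ⟦X⟧) : coeff n (2 * f) = 2 * coeff n f := by
  rw [← coeff_C_mul, map_ofNat]

/-- The element `x f - y` has vanishing odd coefficients at orders up to `w + 8`, all outside `Δ`.
By induction this kills the odd coefficients of `f` below `2 + w`, and at `w + 8` it compares `f`
with the term `t^(w+8)` of `y`. The gap 10 is cleared with `y f`. -/
theorem IsNormalized.coeff_order_two {w : ℕ} (hw : Odd w) {Δ : Set ℕ} {M : Submodule ℂ ℂ⟦X⟧}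
    (hM : IsNormalized w Δ M) (hlow : ∀ k ∈ Δ, Odd k → w + 14 ≤ k) {f : ℂ⟦X⟧} (hf : f ∈ M)
    (hf2 : IsMonicOfOrder f 2) :
    (∀ k < 2 + w, Odd k → coeff k f = 0) ∧ coeff (2 + w) f = 1 := by
  have hw1 : 1 ≤ w := hw.pos
  obtain ⟨hf1, hf0⟩ := isMonicOfOrder_iff.mp hf2
  have hT : genMonomial w 1 0 * f - evenMonomial w 8 ∈ M :=
    sub_mem (hM.mul_mem 1 0 f hf) (hM.evenMonomial_mem 8 (mem_evenSemigroup (by decide)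
      (by decide) (by decide) (by decide)))
  have hx : genMonomial w 1 0 * f = X ^ 6 * f := by rw [genMonomial]; ring
  have h8 : ∀ k ≤ 8, coeff k (evenMonomial w 8) = if k = 8 then 1 else 0 := by
    intro k hk
    obtain ⟨h1, h0⟩ := isMonicOfOrder_iff.mp (isMonicOfOrder_evenMonomial (w := w) (by omega) 8)
    rcases hk.eq_or_lt with rfl | hk
    · rw [h1, if_pos rfl]
    · rw [h0 k hk, if_neg (by omega)]
  have step : ∀ B, Odd B → B ≤ 2 + w → (∀ k < B, Odd k → coeff k f = 0) →
      coeff (6 + B) (genMonomial w 1 0 * f - evenMonomial w 8) = 0 := by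
    intro B hBo hB hz
    refine hM.coeff_eq_zero (n₀ := 10) (by norm_num) (by omega)
      (fun h => absurd (hlow _ h ((by decide : Even 6).add_odd hBo)) (by omega))
      (fun _ => ⟨_, hM.mul_mem 0 1 f hf, ?_, fun k hk hko => ?_⟩) hT
      ((by decide : Even 6).add_odd hBo) fun k hk h => ?_
    · exact (isMonicOfOrder_genMonomial (by omega) 0 1).mul hf2
    · rw [genMonomial_zero_one_mul, map_add,
        coeff_shift_eq_zero hf0 hz (Or.inr ⟨by omega, hko, by decide⟩),
        coeff_shift_eq_zero hf0 hz (Or.inl (by omega)), add_zero]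
    · rw [map_sub, hx]
      rcases Nat.even_or_odd k with hke | hko
      · have hk10 : k < 10 := by
          rcases h with h | h
          · exact h
          · exact absurd hke (Nat.not_even_iff_odd.mpr h)
        have hk9 : k ≤ 8 := by
          obtain ⟨t, rfl⟩ := hke; omega
        rw [h8 k hk9]
        rcases hk9.eq_or_lt with rfl | hk9
        · rw [coeff_shift (k := 2) rfl, hf1, if_pos rfl, sub_self]
        · rw [coeff_shift_eq_zero hf0 hz (Or.inl (by omega)), if_neg (by omega), sub_zero]
      · rw [coeff_shift_eq_zero hf0 hz (Or.inr ⟨by omega, hko, by decide⟩),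
          coeff_evenMonomial_of_odd (by decide) hko, if_neg (by omega), sub_zero]
  have main : ∀ B ≤ 2 + w, ∀ k < B, Odd k → coeff k f = 0 := by
    intro B
    induction B with
    | zero => intro _ k hk; omega
    | succ B ih =>
      intro hB k hk hko
      rcases (Nat.lt_succ_iff.mp hk).lt_or_eq with h | rfl
      · exact ih (by omega) k h hko
      · have := step k hko (by omega) (ih (by omega))
        rwa [map_sub, hx, coeff_shift rfl, coeff_evenMonomial_of_odd (by decide)
          ((by decide : Even 6).add_odd hko), if_neg (by omega), sub_zero] at this
  refine ⟨main _ le_rfl, ?_⟩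
  have hodd : Odd (2 + w) := (by decide : Even 2).add_odd hw
  have := step (2 + w) hodd le_rfl (main _ le_rfl)
  rw [map_sub, hx, coeff_shift rfl, coeff_evenMonomial_of_odd (by decide)
    ((by decide : Even 6).add_odd hodd), if_pos (by omega)] at this
  norm_num at this
  linear_combination this

/-- The same argument with `y f - x^2`: the leading term of `f` times `t^(8+w)` contributes 1 at
order `12 + w`, which the coefficient of `f` at `4 + w` has to cancel. -/
theorem IsNormalized.coeff_order_four {w : ℕ} (hw : Odd w) {Δ : Set ℕ} {M : Submodule ℂ ℂ⟦X⟧}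
    (hM : IsNormalized w Δ M) (hlow : ∀ k ∈ Δ, Odd k → w + 14 ≤ k) {f : ℂ⟦X⟧} (hf : f ∈ M)
    (hf4 : IsMonicOfOrder f 4) :
    (∀ k < 4 + w, Odd k → coeff k f = 0) ∧ coeff (4 + w) f = -1 := by
  have hw1 : 1 ≤ w := hw.pos
  obtain ⟨hf1, hf0⟩ := isMonicOfOrder_iff.mp hf4
  have hT : genMonomial w 0 1 * f - evenMonomial w 12 ∈ M :=
    sub_mem (hM.mul_mem 0 1 f hf) (hM.evenMonomial_mem 12 (mem_evenSemigroup (by decide)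
      (by decide) (by decide) (by decide)))
  have h12 : evenMonomial w 12 = X ^ 12 := by rw [evenMonomial]; norm_num
  have step : ∀ B, Odd B → B ≤ 4 + w → (∀ k < B, Odd k → coeff k f = 0) →
      coeff (8 + B) (genMonomial w 0 1 * f - evenMonomial w 12) = 0 := by
    intro B hBo hB hz
    refine hM.coeff_eq_zero (n₀ := 14) (by norm_num) (by omega)
      (fun h => absurd (hlow _ h ((by decide : Even 8).add_odd hBo)) (by omega))
      (fun h => by omega) hT ((by decide : Even 8).add_odd hBo) fun k hk h => ?_
    rw [map_sub, genMonomial_zero_one_mul, map_add, h12, coeff_X_pow,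
      coeff_shift_eq_zero (s := 8 + w) hf0 hz (Or.inl (by omega)), add_zero]
    rcases Nat.even_or_odd k with hke | hko
    · have hk9 : k ≤ 12 := by
        rcases h with h | h
        · obtain ⟨t, rfl⟩ := hke; omega
        · exact absurd hke (Nat.not_even_iff_odd.mpr h)
      rcases hk9.eq_or_lt with rfl | hk9
      · rw [coeff_shift (k := 4) rfl, hf1, if_pos rfl, sub_self]
      · rw [coeff_shift_eq_zero hf0 hz (Or.inl (by omega)), if_neg (by omega), sub_zero]
    · rw [coeff_shift_eq_zero hf0 hz (Or.inr ⟨by omega, hko, by decide⟩),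
        if_neg (by rintro rfl; exact absurd hko (by decide)), sub_zero]
  have main : ∀ B ≤ 4 + w, ∀ k < B, Odd k → coeff k f = 0 := by
    intro B
    induction B with
    | zero => intro _ k hk; omega
    | succ B ih =>
      intro hB k hk hko
      rcases (Nat.lt_succ_iff.mp hk).lt_or_eq with h | rfl
      · exact ih (by omega) k h hko
      · have := step k hko (by omega) (ih (by omega))
        rwa [map_sub, genMonomial_zero_one_mul, map_add, coeff_shift rfl, h12, coeff_X_pow,
          coeff_shift_eq_zero hf0 (ih (by omega)) (Or.inl (by omega)), add_zero,
          if_neg (by rintro h; obtain ⟨t, rfl⟩ := hko; omega), sub_zero] at this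
  refine ⟨main _ le_rfl, ?_⟩
  have hodd : Odd (4 + w) := (by decide : Even 4).add_odd hw
  have := step (4 + w) hodd le_rfl (main _ le_rfl)
  rw [map_sub, genMonomial_zero_one_mul, map_add, coeff_shift rfl, h12, coeff_X_pow,
    coeff_shift (k := 4) (by omega), hf1, if_neg (by obtain ⟨t, rfl⟩ := hw; omega)] at this
  linear_combination this

/-- If an odd `k ∈ Δ` does not exceed a missing exponent `w + t`, the difference must be one of the
even gaps 2, 4, 10. For `k < w + 14` this cannot hold for all the missing exponents of a clause that
exceed or equal `k`, unless `k` is above some of them, and the parity and gap conditions exclude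
that as well. -/
theorem IsPreModule.le_of_isBad {w : ℕ} (hw : Odd w) {Δ : Set ℕ} (hΔ : IsPreModule w Δ)
    (hbad : IsBad w Δ) : ∀ k ∈ Δ, Odd k → w + 14 ≤ k := by
  intro k hk hko
  by_contra hlt
  have key : ∀ t, Even t → w + t ∉ Δ → k ≤ w + t → w + t = k + 2 ∨ w + t = k + 4 ∨ w + t = k + 10 := by
    intro t ht hn hle
    by_contra hc
    push Not at hc
    exact hn (hΔ.mem_of_sub hk hle ((hw.add_even ht).tsub_odd hko) hc.1 hc.2.1 hc.2.2)
  obtain ⟨r, hr⟩ := hw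
  obtain ⟨s, hs⟩ := hko
  rcases hbad with ⟨-, -, -, h16, h18⟩ | ⟨-, -, h8, h18⟩ | ⟨-, -, h12, h16⟩ | ⟨-, -, h8, h10, h12⟩
  · have h1 := key 16 (by decide) h16
    have h2 := key 18 (by decide) h18
    omega
  · have h1 := key 8 (by decide) h8
    have h2 := key 18 (by decide) h18
    omega
  · have h1 := key 12 (by decide) h12
    have h2 := key 16 (by decide) h16
    omega
  · have h1 := key 8 (by decide) h8
    have h2 := key 10 (by decide) h10
    have h3 := key 12 (by decide) h12
    omega

/-- Comparing `x f` with `y^2` forces the coefficient of `f` at `10 + w` to be 2; comparing `y f`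
with `x^3` forces it to be -1. -/
theorem IsNormalized.not_order_ten {w : ℕ} (hw : Odd w) {Δ : Set ℕ} {M : Submodule ℂ ℂ⟦X⟧}
    (hM : IsNormalized w Δ M) (hlow : ∀ k ∈ Δ, Odd k → w + 14 ≤ k) (h10 : 10 ∈ Δ)
    (h16 : w + 16 ∉ Δ) (h18 : w + 18 ∉ Δ) : False := by
  have hw1 : 1 ≤ w := hw.pos
  obtain ⟨f, hf, hfm⟩ := hM.exists_monic 10 h10
  obtain ⟨hf1, hf0⟩ := isMonicOfOrder_iff.mp hfm
  have hT : genMonomial w 1 0 * f - evenMonomial w 16 ∈ M :=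
    sub_mem (hM.mul_mem 1 0 f hf) (hM.evenMonomial_mem 16 (mem_evenSemigroup (by decide)
      (by decide) (by decide) (by decide)))
  have hx : genMonomial w 1 0 * f = X ^ 6 * f := by rw [genMonomial]; ring
  obtain ⟨h161, h160⟩ := isMonicOfOrder_iff.mp (isMonicOfOrder_evenMonomial (w := w) (by omega) 16)
  have hT' : genMonomial w 0 1 * f - evenMonomial w 18 ∈ M :=
    sub_mem (hM.mul_mem 0 1 f hf) (hM.evenMonomial_mem 18 (mem_evenSemigroup (by decide)
      (by decide) (by decide) (by decide)))
  have h18e : evenMonomial w 18 = X ^ 18 := by rw [evenMonomial]; norm_num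
  have step : ∀ B, Odd B → B ≤ 10 + w → 6 + B ∉ Δ → (∀ k < B, Odd k → coeff k f = 0) →
      coeff (6 + B) (genMonomial w 1 0 * f - evenMonomial w 16) = 0 := by
    intro B hBo hB hBΔ hz
    refine hM.coeff_eq_zero (n₀ := 18) (by norm_num) (by omega) hBΔ (fun h => by omega) hT
      ((by decide : Even 6).add_odd hBo) fun k hk h => ?_
    rw [map_sub, hx]
    rcases Nat.even_or_odd k with hke | hko
    · have hk9 : k ≤ 16 := by
        rcases h with h | h
        · obtain ⟨t, rfl⟩ := hke; omega
        · exact absurd hke (Nat.not_even_iff_odd.mpr h)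
      rcases hk9.eq_or_lt with rfl | hk9
      · rw [coeff_shift (k := 10) rfl, hf1, h161, sub_self]
      · rw [coeff_shift_eq_zero hf0 hz (Or.inl (by omega)), h160 k hk9, sub_zero]
    · rw [coeff_shift_eq_zero hf0 hz (Or.inr ⟨by omega, hko, by decide⟩),
        coeff_evenMonomial_of_odd (by decide) hko, if_neg (by omega), sub_zero]
  have step' : ∀ B, Odd B → B ≤ 10 + w → 8 + B ∉ Δ → (∀ k < B, Odd k → coeff k f = 0) →
      coeff (8 + B) (genMonomial w 0 1 * f - evenMonomial w 18) = 0 := by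
    intro B hBo hB hBΔ hz
    refine hM.coeff_eq_zero (n₀ := 20) (by norm_num) (by omega) hBΔ (fun h => by omega) hT'
      ((by decide : Even 8).add_odd hBo) fun k hk h => ?_
    rw [map_sub, genMonomial_zero_one_mul, map_add, h18e, coeff_X_pow,
      coeff_shift_eq_zero (s := 8 + w) hf0 hz (Or.inl (by omega)), add_zero]
    rcases Nat.even_or_odd k with hke | hko
    · have hk9 : k ≤ 18 := by
        rcases h with h | h
        · obtain ⟨t, rfl⟩ := hke; omega
        · exact absurd hke (Nat.not_even_iff_odd.mpr h)
      rcases hk9.eq_or_lt with rfl | hk9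
      · rw [coeff_shift (k := 10) rfl, hf1, if_pos rfl, sub_self]
      · rw [coeff_shift_eq_zero hf0 hz (Or.inl (by omega)), if_neg (by omega), sub_zero]
    · rw [coeff_shift_eq_zero hf0 hz (Or.inr ⟨by omega, hko, by decide⟩),
        if_neg (by rintro rfl; exact absurd hko (by decide)), sub_zero]
  have main : ∀ B ≤ 10 + w, ∀ k < B, Odd k → coeff k f = 0 := by
    intro B
    induction B with
    | zero => intro _ k hk; omega
    | succ B ih =>
      intro hB k hk hko
      rcases (Nat.lt_succ_iff.mp hk).lt_or_eq with h | rfl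
      · exact ih (by omega) k h hko
      -- Multiplication by `x` moves `8 + w` to `w + 14`, which may belong to `Δ`; multiplication by
      -- `y` moves it to `w + 16`, which does not.
      · rcases eq_or_ne k (8 + w) with hkw | hkw
        · have := step' k hko (by omega) (by rwa [hkw, show 8 + (8 + w) = w + 16 by ring])
            (ih (by omega))
          rwa [map_sub, genMonomial_zero_one_mul, map_add, coeff_shift rfl, h18e, coeff_X_pow,
            coeff_shift_eq_zero hf0 (ih (by omega)) (Or.inl (by omega)), add_zero,
            if_neg (by rintro h; obtain ⟨t, rfl⟩ := hko; omega), sub_zero] at this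
        · have hk6 : Odd (6 + k) := (by decide : Even 6).add_odd hko
          have := step k hko (by omega) (fun h => by
            have := hlow _ h hk6
            obtain ⟨t, rfl⟩ := hko
            obtain ⟨s, rfl⟩ := hw
            omega) (ih (by omega))
          rwa [map_sub, hx, coeff_shift rfl, coeff_evenMonomial_of_odd (by decide) hk6,
            if_neg (by omega), sub_zero] at this
  have hodd : Odd (10 + w) := (by decide : Even 10).add_odd hw
  have e1 := step (10 + w) hodd le_rfl (by rwa [show 6 + (10 + w) = w + 16 by ring])
    (main _ le_rfl)
  have e2 := step' (10 + w) hodd le_rfl (by rwa [show 8 + (10 + w) = w + 18 by ring])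
    (main _ le_rfl)
  rw [map_sub, hx, coeff_shift rfl, coeff_evenMonomial_of_odd (by decide)
    ((by decide : Even 6).add_odd hodd), if_pos (by omega)] at e1
  rw [map_sub, genMonomial_zero_one_mul, map_add, coeff_shift rfl, h18e, coeff_X_pow,
    coeff_shift (k := 10) (by omega), hf1, if_neg (by obtain ⟨t, rfl⟩ := hw; omega)] at e2
  norm_num at e1 e2
  have : (3 : ℂ) = 0 := by linear_combination e2 - e1
  norm_num at this

theorem IsPreModule.not_isAdmissible_of_isBad {w : ℕ} {hv : 9 ≤ w + 8} (hw : Odd w) {Δ : Set ℕ}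
    (hΔ : IsPreModule w Δ) (hbad : IsBad w Δ) : ¬ IsAdmissible (w + 8) hv Δ := by
  intro hadm
  obtain ⟨M, hM⟩ := hadm.exists_isNormalized hΔ.zero_mem
  have hlow := hΔ.le_of_isBad hw hbad
  rcases hbad with ⟨h10, -, -, h16, h18⟩ | ⟨h2, -, h8, h18⟩ | ⟨-, h4, h12, h16⟩ |
    ⟨h2, h4, h8, h10, h12⟩
  · exact hM.not_order_ten hw hlow h10 h16 h18
  · obtain ⟨f, hf, hfm⟩ := hM.exists_monic 2 h2
    obtain ⟨hf1, hf0⟩ := isMonicOfOrder_iff.mp hfm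
    obtain ⟨hz, hc⟩ := hM.coeff_order_two hw hlow hf hfm
    -- In `y^2 f - x^3` the coefficient at `w + 18` is `1 + 2 = 3`, yet it should vanish.
    have hT : genMonomial w 0 2 * f - evenMonomial w 18 ∈ M :=
      sub_mem (hM.mul_mem 0 2 f hf) (hM.evenMonomial_mem 18 (mem_evenSemigroup (by decide)
        (by decide) (by decide) (by decide)))
    have h18e : evenMonomial w 18 = X ^ 18 := by rw [evenMonomial]; norm_num
    have := hM.coeff_eq_zero (A := w + 18) (n₀ := 20) (by norm_num) (by omega) h18
      (fun h => by omega) hT (hw.add_even (by decide)) fun k hk h => by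
        rw [map_sub, genMonomial_zero_two_mul, map_add, map_add, coeff_two_mul, h18e, coeff_X_pow,
          coeff_shift_eq_zero (s := 16 + w) hf0 hz (Or.inl (by omega)),
          coeff_shift_eq_zero (s := 16 + 2 * w) hf0 hz (Or.inl (by omega)), mul_zero, add_zero,
          add_zero]
        rcases Nat.even_or_odd k with hke | hko
        · have hk9 : k ≤ 18 := by
            rcases h with h | h
            · obtain ⟨t, rfl⟩ := hke; omega
            · exact absurd hke (Nat.not_even_iff_odd.mpr h)
          rcases hk9.eq_or_lt with rfl | hk9
          · rw [coeff_shift (k := 2) rfl, hf1, if_pos rfl, sub_self]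
          · rw [coeff_shift_eq_zero hf0 hz (Or.inl (by omega)), if_neg (by omega), sub_zero]
        · rw [coeff_shift_eq_zero hf0 hz (Or.inr ⟨by omega, hko, by decide⟩),
            if_neg (by rintro rfl; exact absurd hko (by decide)), sub_zero]
    rw [map_sub, genMonomial_zero_two_mul, map_add, map_add, coeff_two_mul, h18e, coeff_X_pow,
      coeff_shift_eq_zero (s := 16 + 2 * w) hf0 hz (Or.inl (by omega)),
      coeff_shift (s := 16 + w) (k := 2) (by omega), coeff_shift (k := 2 + w) (by omega), hc, hf1,
      if_neg (by omega)] at this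
    norm_num at this
  · obtain ⟨f, hf, hfm⟩ := hM.exists_monic 4 h4
    obtain ⟨hf1, hf0⟩ := isMonicOfOrder_iff.mp hfm
    obtain ⟨hz, hc⟩ := hM.coeff_order_four hw hlow hf hfm
    -- In `x^2 f - y^2` the coefficient at `w + 16` is `-1 - 2 = -3`, yet it should vanish.
    have hT : genMonomial w 2 0 * f - evenMonomial w 16 ∈ M :=
      sub_mem (hM.mul_mem 2 0 f hf) (hM.evenMonomial_mem 16 (mem_evenSemigroup (by decide)
        (by decide) (by decide) (by decide)))
    have hx : genMonomial w 2 0 * f = X ^ 12 * f := by rw [genMonomial]; ring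
    obtain ⟨h161, h160⟩ :=
      isMonicOfOrder_iff.mp (isMonicOfOrder_evenMonomial (w := w) (by omega) 16)
    have := hM.coeff_eq_zero (A := w + 16) (n₀ := 18) (by norm_num) (by omega) h16
      (fun h => by omega) hT (hw.add_even (by decide)) fun k hk h => by
        rw [map_sub, hx]
        rcases Nat.even_or_odd k with hke | hko
        · have hk9 : k ≤ 16 := by
            rcases h with h | h
            · obtain ⟨t, rfl⟩ := hke; omega
            · exact absurd hke (Nat.not_even_iff_odd.mpr h)
          rcases hk9.eq_or_lt with rfl | hk9
          · rw [coeff_shift (k := 4) rfl, hf1, h161, sub_self]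
          · rw [coeff_shift_eq_zero hf0 hz (Or.inl (by omega)), h160 k hk9, sub_zero]
        · rw [coeff_shift_eq_zero hf0 hz (Or.inr ⟨by omega, hko, by decide⟩),
            coeff_evenMonomial_of_odd (by decide) hko, if_neg (by omega), sub_zero]
    rw [map_sub, hx, coeff_shift (k := 4 + w) (by omega), hc, coeff_evenMonomial_of_odd (by decide)
      (hw.add_even (by decide)), if_pos (by omega)] at this
    norm_num at this
  · obtain ⟨f, hf, hfm⟩ := hM.exists_monic 2 h2
    obtain ⟨hf1, hf0⟩ := isMonicOfOrder_iff.mp hfm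
    obtain ⟨hz, hc⟩ := hM.coeff_order_two hw hlow hf hfm
    obtain ⟨g, hg, hgm⟩ := hM.exists_monic 4 h4
    obtain ⟨hg1, hg0⟩ := isMonicOfOrder_iff.mp hgm
    obtain ⟨hgz, hgc⟩ := hM.coeff_order_four hw hlow hg hgm
    -- In `x g - y f` the coefficient at `w + 10` is `-1 - (1 + 1) = -3`, yet it should vanish.
    have hT : genMonomial w 1 0 * g - genMonomial w 0 1 * f ∈ M :=
      sub_mem (hM.mul_mem 1 0 g hg) (hM.mul_mem 0 1 f hf)
    have hx : genMonomial w 1 0 * g = X ^ 6 * g := by rw [genMonomial]; ring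
    have := hM.coeff_eq_zero (A := w + 10) (n₀ := 12) (by norm_num) (by omega) h10
      (fun h => by omega) hT (hw.add_even (by decide)) fun k hk h => by
        rw [map_sub, hx, genMonomial_zero_one_mul, map_add,
          coeff_shift_eq_zero (s := 8 + w) hf0 hz (Or.inl (by omega)), add_zero]
        rcases Nat.even_or_odd k with hke | hko
        · have hk9 : k ≤ 10 := by
            rcases h with h | h
            · obtain ⟨t, rfl⟩ := hke; omega
            · exact absurd hke (Nat.not_even_iff_odd.mpr h)
          rcases hk9.eq_or_lt with rfl | hk9
          · rw [coeff_shift (k := 4) rfl, coeff_shift (k := 2) rfl, hf1, hg1, sub_self]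
          · rw [coeff_shift_eq_zero hf0 hz (Or.inl (by omega)),
              coeff_shift_eq_zero hg0 hgz (Or.inl (by omega)), sub_zero]
        · rw [coeff_shift_eq_zero hf0 hz (Or.inr ⟨by omega, hko, by decide⟩),
            coeff_shift_eq_zero hg0 hgz (Or.inr ⟨by omega, hko, by decide⟩), sub_zero]
    rw [map_sub, hx, genMonomial_zero_one_mul, map_add, coeff_shift (k := 4 + w) (by omega), hgc,
      coeff_shift (k := 2 + w) (by omega), hc, coeff_shift (k := 2) (by omega), hf1] at this
    norm_num at this

/-! ### Modules generated by twisted monomials -/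

/-- A generator of order `n`: a monomial times a power of `1 + t^w`, and, for odd `n`, times a
common unit `V`. -/
noncomputable def twistedMonomial (w : ℕ) (V : ℂ⟦X⟧) (c d : ℕ → ℕ) (n : ℕ) : ℂ⟦X⟧ :=
  if Even n then X ^ n * hUnit w ^ c n else X ^ n * (V * hUnit w ^ d n)

theorem isMonicOfOrder_twistedMonomial {w : ℕ} (hw : w ≠ 0) {V : ℂ⟦X⟧} (hV : constantCoeff V = 1)
    (c d : ℕ → ℕ) (n : ℕ) : IsMonicOfOrder (twistedMonomial w V c d n) n := by
  unfold twistedMonomial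
  split_ifs
  · exact isMonicOfOrder_X_pow_mul n (constantCoeff_hUnit_pow hw _)
  · exact isMonicOfOrder_X_pow_mul n (by rw [map_mul, hV, constantCoeff_hUnit_pow hw, one_mul])

/-- The unit `U` for which `t^e h^s (h^3 - 1) = 3 t^(e + w) U`, where `h = 1 + t^w`. -/
noncomputable def defectUnit (w s : ℕ) : ℂ⟦X⟧ :=
  hUnit w ^ s * (1 + X ^ w + C (1 / 3) * X ^ (2 * w))

theorem constantCoeff_defectUnit {w : ℕ} (hw : w ≠ 0) (s : ℕ) :
    constantCoeff (defectUnit w s) = 1 := by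
  simp [defectUnit, hw]

/-- The difference of two monomials of the same order whose unit factors differ by a third power. -/
noncomputable def defect (w e s : ℕ) : ℂ⟦X⟧ := X ^ e * hUnit w ^ s * (hUnit w ^ 3 - 1)

theorem defect_eq (w e s : ℕ) : defect w e s = (3 : ℂ) • (X ^ (e + w) * defectUnit w s) := by
  have h3 : (3 : ℂ⟦X⟧) * C (1 / 3) = 1 := by
    rw [show (3 : ℂ⟦X⟧) = C 3 by rw [map_ofNat], ← map_mul]; norm_num
  rw [defect, defectUnit, smul_eq_C_mul, map_ofNat]
  linear_combination -(X ^ e * hUnit w ^ s * X ^ (3 * w)) * h3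

theorem X_pow_dvd_hUnit_pow_sub (w a b : ℕ) : (X : ℂ⟦X⟧) ^ w ∣ hUnit w ^ a - hUnit w ^ b := by
  have h : ∀ a, (X : ℂ⟦X⟧) ^ w ∣ hUnit w ^ a - 1 := by
    intro a
    have := sub_dvd_pow_sub_pow (hUnit w) 1 a
    rwa [one_pow, show hUnit w - 1 = X ^ w by rw [hUnit]; ring] at this
  rw [show hUnit w ^ a - hUnit w ^ b = (hUnit w ^ a - 1) - (hUnit w ^ b - 1) by ring]
  exact dvd_sub (h a) (h b)

/-- The exponents `m`, `n` of the units of two monomials of order `k` agree, or the difference of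
the monomials is a multiple of the basic defect. -/
def DefectMultiple (e s k m n : ℕ) : Prop :=
  m = n ∨ ∃ a b, k = e + 6 * a + 8 * b ∧ (m = s + b ∧ n = s + b + 3 ∨ m = s + b + 3 ∧ n = s + b)

theorem DefectMultiple.sub_mem {w e s k m n : ℕ} (h : DefectMultiple e s k m n)
    {W : Submodule ℂ ℂ⟦X⟧} (hW : ∀ a b, genMonomial w a b * defect w e s ∈ W) :
    X ^ k * hUnit w ^ m - X ^ k * hUnit w ^ n ∈ W := by
  rcases h with rfl | ⟨a, b, rfl, ⟨rfl, rfl⟩ | ⟨rfl, rfl⟩⟩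
  · rw [sub_self]; exact W.zero_mem
  · convert W.neg_mem (hW a b) using 1
    rw [genMonomial, defect]; ring
  · convert hW a b using 1
    rw [genMonomial, defect]; ring

/-- Data which makes the odd monomials generate a module, up to order `N`. -/
structure IsOddTwist (w : ℕ) (Δ : Set ℕ) (N : ℕ) (d : ℕ → ℕ) : Prop where
  mem : ∀ n, N ≤ n → n ∈ Δ
  add_six : ∀ o ∈ Δ, Odd o → N ≤ o + 6 ∨ d (o + 6) = d o
  add_eight : ∀ o ∈ Δ, Odd o → N ≤ o + 8 + w ∨ d (o + 8) = d o + 1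

theorem twistedMonomial_of_even {w : ℕ} {V : ℂ⟦X⟧} {c d : ℕ → ℕ} {n : ℕ} (hn : Even n) :
    twistedMonomial w V c d n = X ^ n * hUnit w ^ c n := if_pos hn

theorem twistedMonomial_of_odd {w : ℕ} {V : ℂ⟦X⟧} {c d : ℕ → ℕ} {n : ℕ} (hn : Odd n) :
    twistedMonomial w V c d n = X ^ n * (V * hUnit w ^ d n) :=
  if_neg (Nat.not_even_iff_odd.mpr hn)

theorem genMonomial_mul_mem {w : ℕ} {W : Submodule ℂ ℂ⟦X⟧} (hx : ∀ f ∈ W, X ^ 6 * f ∈ W)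
    (hy : ∀ f ∈ W, X ^ 8 * hUnit w * f ∈ W) (a b : ℕ) {f : ℂ⟦X⟧} (hf : f ∈ W) :
    genMonomial w a b * f ∈ W := by
  have hb : (X ^ 8 * hUnit w) ^ b * f ∈ W := by
    induction b with
    | zero => rwa [pow_zero, one_mul]
    | succ b ih => rw [pow_succ', mul_assoc]; exact hy _ ih
  have ha : (X ^ 6) ^ a * ((X ^ 8 * hUnit w) ^ b * f) ∈ W := by
    induction a with
    | zero => rwa [pow_zero, one_mul]
    | succ a ih => rw [pow_succ', mul_assoc]; exact hx _ ih
  convert ha using 1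
  rw [genMonomial, mul_pow, pow_add, pow_mul, pow_mul]; ring

/-- The span of the odd generators of a module. -/
noncomputable def oddSpan (w : ℕ) (V : ℂ⟦X⟧) (c d : ℕ → ℕ) (Δ : Set ℕ) (N : ℕ) :
    Submodule ℂ ℂ⟦X⟧ :=
  triSpan (twistedMonomial w V c d) (Δ ∩ {n | Odd n}) N

theorem mem_oddSpan_of_dvd {w : ℕ} {V : ℂ⟦X⟧} {c d : ℕ → ℕ} {Δ : Set ℕ} {N : ℕ} {f : ℂ⟦X⟧}
    (hf : X ^ N ∣ f) : f ∈ oddSpan w V c d Δ N :=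
  tail_le_triSpan _ _ _ hf

theorem twistedMonomial_mem_oddSpan {w : ℕ} {V : ℂ⟦X⟧} {c d : ℕ → ℕ} {Δ : Set ℕ} {N n : ℕ}
    (hn : n ∈ Δ) (ho : Odd n) : twistedMonomial w V c d n ∈ oddSpan w V c d Δ N :=
  mem_triSpan_of_mem N ⟨hn, ho⟩

theorem IsPreModule.X_pow_six_mul_mem_oddSpan {w : ℕ} {Δ : Set ℕ} (hΔ : IsPreModule w Δ)
    {N : ℕ} {c d : ℕ → ℕ} (V : ℂ⟦X⟧) (hd : IsOddTwist w Δ N d) {f : ℂ⟦X⟧}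
    (hf : f ∈ oddSpan w V c d Δ N) : X ^ 6 * f ∈ oddSpan w V c d Δ N := by
  refine mul_mem_triSpan ?_ hf
  rintro n ⟨hn, hno⟩
  have e6 : X ^ 6 * twistedMonomial w V c d n = X ^ (n + 6) * (V * hUnit w ^ d n) := by
    rw [twistedMonomial_of_odd hno]; ring
  have ho : Odd (n + 6) := Odd.add_even hno (by decide)
  rcases hd.add_six n hn hno with h | h
  · rw [e6]
    exact mem_oddSpan_of_dvd ((pow_dvd_pow X h).mul_right _)
  · rw [e6, ← h, ← twistedMonomial_of_odd (c := c) ho]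
    exact twistedMonomial_mem_oddSpan (hΔ.add_six n hn) ho

/-- Any two powers of `h` agree modulo `t^w`, so a mismatch of exponents costs an error of order `n
+ 8 + w` only. This is why `IsOddTwist` asks for the exact exponent just below that threshold. -/
theorem IsPreModule.X_pow_eight_mul_mem_oddSpan {w : ℕ} {Δ : Set ℕ} (hΔ : IsPreModule w Δ)
    {N : ℕ} {c d : ℕ → ℕ} (V : ℂ⟦X⟧) (hd : IsOddTwist w Δ N d) {f : ℂ⟦X⟧}
    (hf : f ∈ oddSpan w V c d Δ N) : X ^ 8 * hUnit w * f ∈ oddSpan w V c d Δ N := by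
  refine mul_mem_triSpan ?_ hf
  rintro n ⟨hn, hno⟩
  have ho : Odd (n + 8) := Odd.add_even hno (by decide)
  have hn8 : twistedMonomial w V c d (n + 8) ∈ oddSpan w V c d Δ N :=
    twistedMonomial_mem_oddSpan (hΔ.add_eight n hn) ho
  have e8 : X ^ 8 * hUnit w * twistedMonomial w V c d n = twistedMonomial w V c d (n + 8) +
      X ^ (n + 8) * (hUnit w ^ (d n + 1) - hUnit w ^ d (n + 8)) * V := by
    rw [twistedMonomial_of_odd hno, twistedMonomial_of_odd ho]; ring
  rw [e8]
  refine Submodule.add_mem _ hn8 ?_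
  rcases hd.add_eight n hn hno with h | h
  · refine mem_oddSpan_of_dvd (Dvd.dvd.mul_right ((pow_dvd_pow X h).trans ?_) _)
    rw [pow_add]
    exact mul_dvd_mul_left _ (X_pow_dvd_hUnit_pow_sub w _ _)
  · rw [h, sub_self, mul_zero, zero_mul]; exact Submodule.zero_mem _

/-- Even generators are stable up to ring multiples of the defect. The defect is three times the odd
generator of order `e + w`, or lies in the tail, and the odd span is itself stable; so the whole
span is. -/
theorem IsPreModule.isAdmissible_of_twist {w : ℕ} (hv : 9 ≤ w + 8) {Δ : Set ℕ}
    (hΔ : IsPreModule w Δ) {N : ℕ} {c d : ℕ → ℕ} {V : ℂ⟦X⟧} (hV : constantCoeff V = 1)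
    (hd : IsOddTwist w Δ N d) {e s : ℕ} (hodd : Odd (e + w)) (hmem : e + w ∈ Δ)
    (hT : N ≤ e + w ∨ V * hUnit w ^ d (e + w) = defectUnit w s)
    (hx : ∀ n ∈ Δ, Even n → DefectMultiple e s (n + 6) (c n) (c (n + 6)))
    (hy : ∀ n ∈ Δ, Even n → DefectMultiple e s (n + 8) (c n + 1) (c (n + 8))) :
    IsAdmissible (w + 8) hv Δ := by
  have hw : w ≠ 0 := by omega
  have hle : oddSpan w V c d Δ N ≤ triSpan (twistedMonomial w V c d) Δ N :=
    triSpan_mono N Set.inter_subset_left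
  have hdef : defect w e s ∈ oddSpan w V c d Δ N := by
    rw [defect_eq]
    apply Submodule.smul_mem
    rcases hT with h | h
    · exact mem_oddSpan_of_dvd ((pow_dvd_pow X h).mul_right _)
    · rw [← h, ← twistedMonomial_of_odd (c := c) hodd]
      exact twistedMonomial_mem_oddSpan hmem hodd
  have hgen : ∀ a b, genMonomial w a b * defect w e s ∈ oddSpan w V c d Δ N := fun a b =>
    genMonomial_mul_mem (fun f hf => hΔ.X_pow_six_mul_mem_oddSpan V hd hf)
      (fun f hf => hΔ.X_pow_eight_mul_mem_oddSpan V hd hf) a b hdef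
  refine isAdmissible_of_triSpan hv (isMonicOfOrder_twistedMonomial hw hV c d) hd.mem ?_ ?_
  · intro n hn
    rcases Nat.even_or_odd n with hne | hno
    · have he : Even (n + 6) := Even.add hne (by decide)
      have h6 := mem_triSpan_of_mem (m := twistedMonomial w V c d) N (hΔ.add_six n hn)
      have := Submodule.add_mem _ (hle ((hx n hn hne).sub_mem hgen)) h6
      rw [twistedMonomial_of_even he, sub_add_cancel] at this
      rw [twistedMonomial_of_even hne, ← mul_assoc, ← pow_add, add_comm 6]
      exact this
    · exact hle (hΔ.X_pow_six_mul_mem_oddSpan V hd (twistedMonomial_mem_oddSpan hn hno))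
  · intro n hn
    rcases Nat.even_or_odd n with hne | hno
    · have he : Even (n + 8) := Even.add hne (by decide)
      have h8 := mem_triSpan_of_mem (m := twistedMonomial w V c d) N (hΔ.add_eight n hn)
      have := Submodule.add_mem _ (hle ((hy n hn hne).sub_mem hgen)) h8
      rw [twistedMonomial_of_even he, sub_add_cancel] at this
      rw [twistedMonomial_of_even hne, show X ^ 8 * hUnit w * (X ^ n * hUnit w ^ c n) =
        X ^ (n + 8) * hUnit w ^ (c n + 1) by ring]
      exact this
    · exact hle (hΔ.X_pow_eight_mul_mem_oddSpan V hd (twistedMonomial_mem_oddSpan hn hno))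

/-- Let `o` be the least odd element of `Δ`. Its translates by the even semigroup leave gaps only up
to `o + 10`, so the tail can start around there and few conditions on `d` remain. The unit `V` then
adjusts the generator of order `k` to the prescribed `U`. -/
theorem IsPreModule.exists_isOddTwist {w : ℕ} (hw : Odd w) {Δ : Set ℕ} (hΔ : IsPreModule w Δ)
    {k : ℕ} (hk : k ∈ Δ) (hko : Odd k) (h10 : 10 ∈ Δ ∨ 11 ≤ k) {U : ℂ⟦X⟧}
    (hU : constantCoeff U = 1) : ∃ N d V, constantCoeff V = 1 ∧ IsOddTwist w Δ N d ∧
      (N ≤ k ∨ V * hUnit w ^ d k = U) := by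
  classical
  have hw1 := hw.pos
  have hex : ∃ o, o ∈ Δ ∧ Odd o := ⟨k, hk, hko⟩
  obtain ⟨ho, hoo⟩ := Nat.find_spec hex
  have hmin : ∀ n ∈ Δ, Odd n → Nat.find hex ≤ n := fun n hn hno => Nat.find_min' hex ⟨hn, hno⟩
  generalize Nat.find hex = o at ho hoo hmin
  have hoM : ∀ n, Odd n → o ≤ n → n ≠ o + 2 → n ≠ o + 4 → n ≠ o + 10 → n ∈ Δ := fun n hn hle =>
    hΔ.mem_of_sub ho hle (hn.tsub_odd hoo)
  have heM : ∀ n, Even n → 12 ≤ n → n ∈ Δ := fun n hn hle =>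
    hΔ.even_mem hn (by omega) (by omega) (by omega)
  have ho1 := hoo.pos
  by_cases hw3 : 3 ≤ w
  -- For `w ≥ 3` the error `n + 8 + w` is at least `o + 11`, so a constant exponent suffices.
  · refine ⟨o + 11, fun _ => 0, U, hU, ⟨fun n hn => ?_, fun _ _ _ => Or.inr rfl,
      fun n hn hno => Or.inl ?_⟩, Or.inr (by rw [pow_zero, mul_one])⟩
    · rcases Nat.even_or_odd n with h | h
      · exact heM n h (by omega)
      · exact hoM n h (by omega) (by omega) (by omega) (by omega)
    · have := hmin n hn hno; omega
  obtain rfl : w = 1 := by obtain ⟨t, rfl⟩ := hw; omega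
  -- For `w = 1` the error at `n = o` starts at `o + 9`. The tail may start there if it avoids the
  -- gaps `o + 10` and 10.
  by_cases hA : o + 10 ∈ Δ ∧ (3 ≤ o ∨ 10 ∈ Δ)
  · refine ⟨o + 9, fun _ => 0, U, hU, ⟨fun n hn => ?_, fun _ _ _ => Or.inr rfl,
      fun n hn hno => Or.inl ?_⟩, Or.inr (by rw [pow_zero, mul_one])⟩
    · rcases Nat.even_or_odd n with h | h
      · rcases eq_or_ne n 10 with rfl | hne
        · rcases hA.2 with h3 | h3
          · omega
          · exact h3
        · exact heM n h (by obtain ⟨t, rfl⟩ := h; omega)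
      · rcases eq_or_ne n (o + 10) with rfl | hne
        · exact hA.1
        · exact hoM n h (by omega) (by omega) (by omega) hne
    · have := hmin n hn hno; omega
  by_cases hB : o + 10 ∈ Δ
  · have h10' : 10 ∉ Δ := fun h => hA ⟨hB, Or.inr h⟩
    obtain rfl : o = 1 := by
      have : ¬ 3 ≤ o := fun h => hA ⟨hB, Or.inl h⟩
      obtain ⟨t, rfl⟩ := hoo; omega
    -- With `o = 1` the only binding shift by 8 is from 1 to 9, giving `d 9 = 1`, and the shift by 6
    -- from 3 gives `d 3 = d 9`. The order `k` already lies in the tail.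
    refine ⟨11, fun n => if n = 3 ∨ n = 9 then 1 else 0, 1, map_one _, ⟨fun n hn => ?_,
      fun n hn hno => ?_, fun n hn hno => ?_⟩, Or.inl (h10.resolve_left h10')⟩
    · rcases Nat.even_or_odd n with h | h
      · exact heM n h (by obtain ⟨t, rfl⟩ := h; omega)
      · rcases eq_or_ne n 11 with rfl | hne
        · exact hB
        · exact hoM n h (by omega) (by omega) (by omega) (by omega)
    · by_cases h : 11 ≤ n + 6
      · exact Or.inl h
      · right
        obtain ⟨t, rfl⟩ := hno
        have : t < 2 := by omega
        interval_cases t <;> rfl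
    · by_cases h : 11 ≤ n + 8 + 1
      · exact Or.inl h
      · right
        obtain ⟨t, rfl⟩ := hno
        obtain rfl : t = 0 := by omega
        rfl
  -- Only the shift from `o` to `o + 8` binds. Raising `d` at `o + 8` is harmless because `o + 2 ∉
  -- Δ`: otherwise `o + 10` would be in `Δ`.
  · have hd : IsOddTwist 1 Δ (o + 11) (fun n => if n = o + 8 then 1 else 0) := by
      refine ⟨fun n hn => ?_, fun n hn hno => ?_, fun n hn hno => ?_⟩
      · rcases Nat.even_or_odd n with h | h
        · exact heM n h (by omega)
        · exact hoM n h (by omega) (by omega) (by omega) (by omega)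
      · have hne : n ≠ o + 2 := by
          rintro rfl
          exact hB (hΔ.add_eight _ hn)
        by_cases h : n = o + 8
        · left; omega
        · right; rw [if_neg (by omega), if_neg h]
      · have := hmin n hn hno
        rcases this.eq_or_lt with rfl | hlt
        · right; rw [if_pos rfl, if_neg (by omega)]
        · left
          have : n ≠ o + 1 := by
            rintro rfl
            exact Nat.not_even_iff_odd.mpr hno (hoo.add_odd odd_one)
          omega
    by_cases hk8 : k = o + 8
    · have hc : constantCoeff (hUnit 1) = 1 := by simp
      refine ⟨o + 11, _, U * (hUnit 1)⁻¹, ?_, hd, Or.inr ?_⟩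
      · rw [map_mul, hU, constantCoeff_inv, hc, inv_one, one_mul]
      · rw [if_pos hk8, pow_one, mul_assoc, PowerSeries.inv_mul_cancel _ (by
          rw [hc]; exact one_ne_zero), mul_one]
    · exact ⟨o + 11, _, U, hU, hd, Or.inr (by rw [if_neg hk8, pow_zero, mul_one])⟩

/-! ### Choosing the unit exponents at the gaps 2, 4, 10 -/

/-- Exponents of the units of the even generators: the value at `n` is `2 + (n / 2) % 3` except at
the gaps `2`, `4`, `10` of the even part of the semigroup, where it is prescribed. -/
def gapExponent (c₂ c₄ c₁₀ n : ℕ) : ℕ :=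
  if n = 2 then c₂ else if n = 4 then c₄ else if n = 10 then c₁₀ else 2 + n / 2 % 3

/-- The unit exponents `gapExponent c₂ c₄ c₁₀` are compatible with multiplication by the generators
at `n`, up to multiples of the defect with parameters `e` and `s`. -/
def IsGapExponent (c₂ c₄ c₁₀ e s n : ℕ) : Prop :=
  DefectMultiple e s (n + 6) (gapExponent c₂ c₄ c₁₀ n) (gapExponent c₂ c₄ c₁₀ (n + 6)) ∧
  DefectMultiple e s (n + 8) (gapExponent c₂ c₄ c₁₀ n + 1) (gapExponent c₂ c₄ c₁₀ (n + 8))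

/-- With `(c₂, c₄, c₁₀) = (3, 4, 4)` the formula `2 + n / 2 % 3` holds at every even `n`. Stability
then fails only under `y` when `n / 2 % 3 = 2`, by `t^(n+8) h^2 (h^3 - 1)`, with `n + 8` divisible
by 6. -/
theorem isGapExponent_uniform {e n : ℕ} (he : e % 6 = 0) (hn : Even n)
    (hle : n / 2 % 3 = 2 → e ≤ n + 8) : IsGapExponent 3 4 4 e 2 n := by
  obtain ⟨t, rfl⟩ := hn
  refine ⟨Or.inl ?_, ?_⟩
  · unfold gapExponent; split_ifs <;> omega
  · by_cases hc : (t + t) / 2 % 3 = 2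
    · have := hle hc
      refine Or.inr ⟨(t + t + 8 - e) / 6, 0, by omega, Or.inr ?_⟩
      unfold gapExponent; split_ifs <;> omega
    · left; unfold gapExponent; split_ifs <;> omega

theorem gapExponent_of_ge {c₂ c₄ c₁₀ n : ℕ} (hn : 12 ≤ n) :
    gapExponent c₂ c₄ c₁₀ n = 2 + n / 2 % 3 := by
  unfold gapExponent; rw [if_neg (by omega), if_neg (by omega), if_neg (by omega)]

/-- Beyond the gaps the only failures come from `y^3` against `x^4`, multiples by powers of `x` of
`t^24 h^2 (h^3 - 1)`. The hypothesis makes that one a multiple of the basic defect. -/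
theorem isGapExponent_of_ge {c₂ c₄ c₁₀ e s n : ℕ} (hn : Even n) (h12 : 12 ≤ n)
    (h : ∃ a b, e + 6 * a + 8 * b = 24 ∧ s + b = 2) : IsGapExponent c₂ c₄ c₁₀ e s n := by
  obtain ⟨t, rfl⟩ := hn
  obtain ⟨a, b, hab, hb⟩ := h
  unfold IsGapExponent DefectMultiple
  rw [gapExponent_of_ge h12, gapExponent_of_ge (by omega), gapExponent_of_ge (by omega)]
  refine ⟨Or.inl (by omega), ?_⟩
  by_cases hc : (t + t) / 2 % 3 = 2
  · exact Or.inr ⟨a + (t + t - 16) / 6, b, by omega, Or.inr (by omega)⟩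
  · exact Or.inl (by omega)

theorem isGapExponent_of_small {c₂ c₄ c₁₀ e s n : ℕ} (hn : Even n)
    (h : ∃ a b, e + 6 * a + 8 * b = 24 ∧ s + b = 2)
    (h0 : n ∈ ({0, 2, 4, 6, 8, 10} : Finset ℕ) → IsGapExponent c₂ c₄ c₁₀ e s n) :
    IsGapExponent c₂ c₄ c₁₀ e s n := by
  rcases lt_or_ge n 12 with hlt | hge
  · apply h0
    obtain ⟨t, rfl⟩ := hn
    have : t < 6 := by omega
    interval_cases t <;> decide
  · exact isGapExponent_of_ge hn hge h

/-- This choice breaks the (2,0)-relation at `w + 8`; the failure at `x m_10`, in order 16, is `y`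
times that defect. -/
theorem isGapExponent_eight {n : ℕ} (hn : Even n) : IsGapExponent 0 1 1 8 0 n := by
  refine isGapExponent_of_small hn ⟨0, 2, rfl, rfl⟩ fun h => ?_
  simp only [Finset.mem_insert, Finset.mem_singleton] at h
  rcases h with rfl | rfl | rfl | rfl | rfl | rfl
  · exact ⟨Or.inl rfl, Or.inl rfl⟩
  · exact ⟨Or.inr ⟨0, 0, rfl, Or.inl ⟨rfl, rfl⟩⟩, Or.inl rfl⟩
  · exact ⟨Or.inl rfl, Or.inl rfl⟩
  · exact ⟨Or.inl rfl, Or.inl rfl⟩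
  · exact ⟨Or.inl rfl, Or.inl rfl⟩
  · exact ⟨Or.inr ⟨0, 1, rfl, Or.inl ⟨rfl, rfl⟩⟩, Or.inl rfl⟩

/-- This choice breaks the (4,2)-relation at `w + 10`; the failure at `x m_10`, in order 16, is `x`
times that defect. -/
theorem isGapExponent_ten {n : ℕ} (hn : Even n) : IsGapExponent 3 1 1 10 1 n := by
  refine isGapExponent_of_small hn ⟨1, 1, rfl, rfl⟩ fun h => ?_
  simp only [Finset.mem_insert, Finset.mem_singleton] at h
  rcases h with rfl | rfl | rfl | rfl | rfl | rfl
  · exact ⟨Or.inl rfl, Or.inl rfl⟩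
  · exact ⟨Or.inl rfl, Or.inr ⟨0, 0, rfl, Or.inr ⟨rfl, rfl⟩⟩⟩
  · exact ⟨Or.inl rfl, Or.inl rfl⟩
  · exact ⟨Or.inl rfl, Or.inl rfl⟩
  · exact ⟨Or.inl rfl, Or.inl rfl⟩
  · exact ⟨Or.inr ⟨1, 0, rfl, Or.inl ⟨rfl, rfl⟩⟩, Or.inl rfl⟩

/-- Without a generator of order 2, the exponents of `isGapExponent_ten` fail no earlier than order
16. -/
theorem isGapExponent_sixteen {n : ℕ} (hn : Even n) (h2 : n ≠ 2) : IsGapExponent 3 1 1 16 1 n := by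
  refine isGapExponent_of_small hn ⟨0, 1, rfl, rfl⟩ fun h => ?_
  simp only [Finset.mem_insert, Finset.mem_singleton] at h
  rcases h with rfl | rfl | rfl | rfl | rfl | rfl
  · exact ⟨Or.inl rfl, Or.inl rfl⟩
  · exact absurd rfl h2
  · exact ⟨Or.inl rfl, Or.inl rfl⟩
  · exact ⟨Or.inl rfl, Or.inl rfl⟩
  · exact ⟨Or.inl rfl, Or.inl rfl⟩
  · exact ⟨Or.inr ⟨0, 0, rfl, Or.inl ⟨rfl, rfl⟩⟩, Or.inl rfl⟩

theorem IsPreModule.isAdmissible_of_isGapExponent {w : ℕ} (hv : 9 ≤ w + 8) (hw : Odd w)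
    {Δ : Set ℕ} (hΔ : IsPreModule w Δ) {c₂ c₄ c₁₀ e s : ℕ} (he : Even e) (hmem : w + e ∈ Δ)
    (h10 : 10 ∈ Δ ∨ 11 ≤ e) (hc : ∀ n ∈ Δ, Even n → IsGapExponent c₂ c₄ c₁₀ e s n) :
    IsAdmissible (w + 8) hv Δ := by
  rw [add_comm] at hmem
  have hodd := he.add_odd hw
  obtain ⟨N, d, V, hV, hd, hT⟩ := hΔ.exists_isOddTwist hw hmem hodd
    (h10.imp_right fun h => h.trans (Nat.le_add_right e w))
    (constantCoeff_defectUnit (by omega : w ≠ 0) s)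
  exact hΔ.isAdmissible_of_twist hv hV hd hodd hmem hT (fun n hn hev => (hc n hn hev).1)
    fun n hn hev => (hc n hn hev).2

/-- Each relation that need not hold, at `w + e ∈ Δ`, is taken as the source of the defect. For `e =
12, 18, 24` the uniform exponents serve, since the first even `n ∈ Δ` with `n / 2 % 3 = 2` is at
least 4, at least 10 if `4 ∉ Δ`, and at least 16 if also `10 ∉ Δ`. -/
theorem IsPreModule.isAdmissible_of_not_isBad {w : ℕ} (hv : 9 ≤ w + 8) (hw : Odd w) {Δ : Set ℕ}
    (hΔ : IsPreModule w Δ) (hbad : ¬ IsBad w Δ) : IsAdmissible (w + 8) hv Δ := by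
  have h24 : w + 24 ∈ Δ := by simpa using hΔ.add_gen 0 hΔ.zero_mem
  obtain ⟨-, -, -, h210, h410⟩ := hΔ.odd_shifts
  obtain ⟨r2, r4, r10, r24⟩ := hΔ.relations_of_not_isBad hbad
  have hne : ∀ {t}, t ∉ Δ → ∀ n ∈ Δ, n ≠ t := by
    rintro t ht n hn rfl; exact ht hn
  have uniform : ∀ e, Even e → w + e ∈ Δ → 11 ≤ e → e % 6 = 0 →
      (∀ n ∈ Δ, Even n → n / 2 % 3 = 2 → e ≤ n + 8) → IsAdmissible (w + 8) hv Δ :=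
    fun e he hmem h10 h6 hle => hΔ.isAdmissible_of_isGapExponent hv hw he hmem (Or.inr h10)
      fun n hn hev => isGapExponent_uniform h6 hev (hle n hn hev)
  have eight : 10 ∈ Δ → w + 8 ∈ Δ → IsAdmissible (w + 8) hv Δ := fun h10 h =>
    hΔ.isAdmissible_of_isGapExponent hv hw (by decide) h (Or.inl h10)
      fun n _ hev => isGapExponent_eight hev
  have sixteen : 2 ∉ Δ → w + 16 ∈ Δ → IsAdmissible (w + 8) hv Δ := fun h2 h =>
    hΔ.isAdmissible_of_isGapExponent hv hw (by decide) h (Or.inr (by norm_num))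
      fun n hn hev => isGapExponent_sixteen hev (hne h2 n hn)
  have twelve : w + 12 ∈ Δ → IsAdmissible (w + 8) hv Δ := fun h =>
    uniform 12 (by decide) h (by norm_num) (by norm_num) fun n _ hev _ => by
      obtain ⟨t, rfl⟩ := hev; omega
  have eighteen : 4 ∉ Δ → w + 18 ∈ Δ → IsAdmissible (w + 8) hv Δ := fun h4 h =>
    uniform 18 (by decide) h (by norm_num) (by norm_num) fun n hn hev _ => by
      have := hne h4 n hn
      obtain ⟨t, rfl⟩ := hev; omega
  by_cases h2 : 2 ∈ Δ <;> by_cases h4 : 4 ∈ Δ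
  · rcases r24 h2 h4 with h | h | h
    · exact eight (h210 h2) h
    · exact hΔ.isAdmissible_of_isGapExponent hv hw (by decide) h (Or.inl (h210 h2))
        fun n _ hev => isGapExponent_ten hev
    · exact twelve h
  · exact (r2 h2).elim (eight (h210 h2)) (eighteen h4)
  · exact (r4 h4).elim twelve (sixteen h2)
  · by_cases h10 : 10 ∈ Δ
    · exact (r10 h10).elim (sixteen h2) (eighteen h4)
    · refine uniform 24 (by decide) h24 (by norm_num) (by norm_num) fun n hn hev _ => ?_
      have := hne h4 n hn
      have := hne h10 n hn
      obtain ⟨t, rfl⟩ := hev; omega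

/-! ### The valuation semigroup -/

/-- The semigroup generated by `6`, `8` and `w + 24`. -/
def fullSemigroup (w : ℕ) : Set ℕ :=
  {n | n ∈ evenSemigroup ∨ ∃ m ∈ evenSemigroup, n = w + 24 + m}

theorem isPreModule_fullSemigroup (w : ℕ) : IsPreModule w (fullSemigroup w) := by
  have h6 : ∀ n ∈ evenSemigroup, n + 6 ∈ evenSemigroup := by
    rintro _ ⟨a, b, hb, rfl⟩; exact ⟨a + 1, b, hb, by ring⟩
  have hev : ∀ n ∈ evenSemigroup, Even n := by
    rintro _ ⟨a, b, -, rfl⟩; exact ⟨3 * a + 4 * b, by ring⟩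
  have h8 : ∀ n ∈ evenSemigroup, n + 8 ∈ evenSemigroup := by
    rintro _ ⟨a, b, hb, rfl⟩
    exact mem_evenSemigroup ⟨3 * a + 4 * b + 4, by ring⟩ (by omega) (by omega) (by omega)
  refine ⟨Or.inl ⟨0, 0, by norm_num, rfl⟩, ?_, ?_, ?_⟩
  · rintro n (hn | ⟨m, hm, rfl⟩)
    · exact Or.inl (h6 n hn)
    · exact Or.inr ⟨m + 6, h6 m hm, by ring⟩
  · rintro n (hn | ⟨m, hm, rfl⟩)
    · exact Or.inl (h8 n hn)
    · exact Or.inr ⟨m + 8, h8 m hm, by ring⟩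
  · rintro n (hn | ⟨m, hm, rfl⟩)
    · exact Or.inr ⟨n, hn, by ring⟩
    · have hm' := hev m hm
      refine Or.inl (mem_evenSemigroup ?_ (by omega) (by omega) (by omega))
      obtain ⟨t, rfl⟩ := hm'
      exact ⟨w + 24 + t, by ring⟩

/-- The right side contains none of 2, 4, 10, so it is not bad and is the valuation set of some
module. Multiplying an element of order 0 of that module by a ring element puts the order of the
latter into the set. -/
theorem semigroupΓ_subset {w : ℕ} {hv : 9 ≤ w + 8} (hw : Odd w) :
    semigroupΓ (w + 8) hv ⊆ fullSemigroup w := by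
  have hpre := isPreModule_fullSemigroup w
  have hev : ∀ n ∈ evenSemigroup, Even n ∧ n ≠ 2 ∧ n ≠ 4 ∧ n ≠ 10 := by
    rintro _ ⟨a, b, -, rfl⟩
    exact ⟨⟨3 * a + 4 * b, by ring⟩, by omega, by omega, by omega⟩
  have hgap : ∀ n, n = 2 ∨ n = 4 ∨ n = 10 → n ∉ fullSemigroup w := by
    rintro n hn (h | ⟨m, -, rfl⟩)
    · have := hev n h; omega
    · omega
  have hbad : ¬ IsBad w (fullSemigroup w) := by
    rintro (h | h | h | h)
    · exact hgap 10 (by simp) h.1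
    · exact hgap 2 (by simp) h.1
    · exact hgap 4 (by simp) h.2.1
    · exact hgap 2 (by simp) h.1
  obtain ⟨M, hM⟩ := hpre.isAdmissible_of_not_isBad hv hw hbad
  rintro n ⟨r, hr, hrn⟩
  have h0 : 0 ∈ valuationSet M := hM ▸ hpre.zero_mem
  obtain ⟨f, hf, hf0⟩ := h0
  rw [← hM]
  refine ⟨r * f, M.smul_mem ⟨r, hr⟩ hf, ?_⟩
  rw [order_mul, hrn, hf0]; simp

theorem IsPreModule.isStandardModule {w : ℕ} {hv : 9 ≤ w + 8} (hw : Odd w) {Δ : Set ℕ}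
    (h : IsPreModule w Δ) : IsStandardModule (w + 8) hv Δ := by
  refine ⟨h.zero_mem, fun g hg d hd => ?_⟩
  rw [add_comm]
  rcases semigroupΓ_subset hw hg with hg | ⟨m, hm, rfl⟩
  · exact h.add_mem hd hg
  · rw [← add_assoc]
    exact h.add_mem (h.add_gen d hd) hm

/-! ### Counting the bad modules -/

/-- The undetermined exponents of an obstructed module: two even ones, and seven odd ones
relative to `w`. -/
abbrev BadCode : Type := Bool × Bool × Bool × Bool × Bool × Bool × Bool × Bool × Bool

/-- Stability under the semigroup, and the obstruction, in terms of the undetermined exponents. -/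
def BadCode.valid : BadCode → Bool
  | (b2, b4, o14, o16, o18, o20, o22, o26, o28) =>
    (!o14 || (o20 && o22)) && (!o16 || o22) && (!o18 || o26) && (!o20 || (o26 && o28)) &&
    (!o22 || o28) && (!b2 || o26) && (!b4 || o28) &&
    (b2 || b4 || (!o16 && !o18)) && (!b2 || b4 || !o18) && (b2 || !b4 || !o16)

theorem card_valid : (Finset.univ.filter fun c : BadCode => c.valid = true).card = 46 := by
  decide +kernel

/-- The set of exponents with the given undetermined part. -/
def BadCode.toSet (w : ℕ) : BadCode → Set ℕ
  | (b2, b4, o14, o16, o18, o20, o22, o26, o28) =>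
    {n | n % 2 = 0 ∧ (n ≠ 2 ∨ b2 = true) ∧ (n ≠ 4 ∨ b4 = true) ∨
      n % 2 = 1 ∧ w + 14 ≤ n ∧ (n ≠ w + 14 ∨ o14 = true) ∧ (n ≠ w + 16 ∨ o16 = true) ∧
        (n ≠ w + 18 ∨ o18 = true) ∧ (n ≠ w + 20 ∨ o20 = true) ∧ (n ≠ w + 22 ∨ o22 = true) ∧
        (n ≠ w + 26 ∨ o26 = true) ∧ (n ≠ w + 28 ∨ o28 = true)}

open Classical in
/-- The undetermined exponents that belong to `Δ`. -/
noncomputable def BadCode.ofSet (w : ℕ) (Δ : Set ℕ) : BadCode :=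
  (decide (2 ∈ Δ), decide (4 ∈ Δ), decide (w + 14 ∈ Δ), decide (w + 16 ∈ Δ), decide (w + 18 ∈ Δ),
    decide (w + 20 ∈ Δ), decide (w + 22 ∈ Δ), decide (w + 26 ∈ Δ), decide (w + 28 ∈ Δ))

theorem BadCode.ofSet_toSet {w : ℕ} (hw : Odd w) (c : BadCode) : ofSet w (c.toSet w) = c := by
  obtain ⟨b2, b4, o14, o16, o18, o20, o22, o26, o28⟩ := c
  have hw' : w % 2 = 1 := Nat.odd_iff.mp hw
  have h : ∀ k, k % 2 = 0 → (w + k) % 2 = 1 := fun k hk => by omega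
  simp [ofSet, toSet, h]

/-- Since `w + 8`, `w + 10`, `w + 12` are absent by construction, the clauses of `IsBad` reduce to
conditions on `w + 16` and `w + 18`, void when both 2 and 4 are present. -/
theorem BadCode.toSet_spec {w : ℕ} (hw : Odd w) {c : BadCode} (hc : c.valid = true) :
    IsPreModule w (c.toSet w) ∧ IsBad w (c.toSet w) := by
  obtain ⟨b2, b4, o14, o16, o18, o20, o22, o26, o28⟩ := c
  have hw' : w % 2 = 1 := Nat.odd_iff.mp hw
  have h : ∀ k, k % 2 = 0 → (w + k) % 2 = 1 := fun k hk => by omega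
  simp only [valid, Bool.and_eq_true, Bool.or_eq_true, Bool.not_eq_true'] at hc
  constructor
  · refine ⟨?_, ?_, ?_, ?_⟩
    · simp [toSet]
    · intro n hn
      simp only [toSet, Set.mem_ofPred_eq] at hn ⊢
      grind
    · intro n hn
      simp only [toSet, Set.mem_ofPred_eq] at hn ⊢
      grind
    · intro n hn
      simp only [toSet, Set.mem_ofPred_eq] at hn ⊢
      grind
  · simp only [IsBad, toSet, Set.mem_ofPred_eq]
    grind

/-- In a bad set 10 is always present and no odd element is below `w + 14`. From `w + 24` on, the
even semigroup fills everything odd except `w + 26`, `w + 28`, `w + 34`, and the last is `10 + (w +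
24)`. -/
theorem BadCode.toSet_ofSet {w : ℕ} (hw : Odd w) {Δ : Set ℕ} (hΔ : IsPreModule w Δ)
    (hbad : IsBad w Δ) : (ofSet w Δ).valid = true ∧ (ofSet w Δ).toSet w = Δ := by
  have h24 : w + 24 ∈ Δ := by simpa using hΔ.add_gen 0 hΔ.zero_mem
  have hlow := hΔ.le_of_isBad hw hbad
  have h10 : 10 ∈ Δ := by
    rcases hbad with h | h | h | h
    · exact h.1
    · exact hΔ.add_eight 2 h.1
    · exact hΔ.add_six 4 h.2.1
    · exact hΔ.add_eight 2 h.1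
  have s6 : ∀ k, w + k ∈ Δ → w + (k + 6) ∈ Δ := fun k hk => hΔ.add_six _ hk
  have s8 : ∀ k, w + k ∈ Δ → w + (k + 8) ∈ Δ := fun k hk => hΔ.add_eight _ hk
  have h26 : 2 ∈ Δ → w + 26 ∈ Δ := fun h => by
    have := hΔ.add_gen 2 h; rwa [show 2 + (w + 24) = w + 26 by ring] at this
  have h28 : 4 ∈ Δ → w + 28 ∈ Δ := fun h => by
    have := hΔ.add_gen 4 h; rwa [show 4 + (w + 24) = w + 28 by ring] at this
  have h34 : w + 34 ∈ Δ := by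
    have := hΔ.add_gen 10 h10; rwa [show 10 + (w + 24) = w + 34 by ring] at this
  constructor
  · have a1 := s6 14
    have a2 := s8 14
    have a3 := s6 16
    have a4 := s8 18
    have a5 := s6 20
    have a6 := s8 20
    have a7 := s6 22
    unfold IsBad at hbad
    simp only [ofSet, valid, Bool.and_eq_true, Bool.or_eq_true, Bool.not_eq_true',
      decide_eq_true_eq, decide_eq_false_iff_not]
    clear hlow s6 s8
    grind
  · ext n
    simp only [ofSet, toSet, Set.mem_ofPred_eq, decide_eq_true_eq]
    constructor
    · rintro (⟨hn, h2, h4⟩ | ⟨hn, hle, h14, h16, h18, h20, h22, h26', h28'⟩)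
      · by_cases e2 : n = 2
        · subst e2; exact h2.resolve_left (by simp)
        by_cases e4 : n = 4
        · subst e4; exact h4.resolve_left (by simp)
        by_cases e10 : n = 10
        · subst e10; exact h10
        exact hΔ.even_mem (Nat.even_iff.mpr hn) e2 e4 e10
      · have res : ∀ k, (n ≠ w + k ∨ w + k ∈ Δ) → n = w + k → n ∈ Δ := by
          rintro k h rfl; exact h.resolve_left (by simp)
        by_cases e14 : n = w + 14
        · exact res 14 h14 e14
        by_cases e16 : n = w + 16
        · exact res 16 h16 e16
        by_cases e18 : n = w + 18
        · exact res 18 h18 e18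
        by_cases e20 : n = w + 20
        · exact res 20 h20 e20
        by_cases e22 : n = w + 22
        · exact res 22 h22 e22
        by_cases e26 : n = w + 26
        · exact res 26 h26' e26
        by_cases e28 : n = w + 28
        · exact res 28 h28' e28
        by_cases e34 : n = w + 34
        · exact res 34 (Or.inr h34) e34
        have hw' := Nat.odd_iff.mp hw
        exact hΔ.mem_of_sub h24 (by omega) (Nat.even_iff.mpr (by omega)) (by omega) (by omega)
          (by omega)
    · intro hn
      have res : ∀ k, n ≠ k ∨ k ∈ Δ := by
        intro k
        by_cases h : n = k
        · subst h; exact Or.inr hn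
        · exact Or.inl h
      rcases Nat.mod_two_eq_zero_or_one n with h | h
      · exact Or.inl ⟨h, res _, res _⟩
      · exact Or.inr ⟨h, hlow n hn (Nat.odd_iff.mpr h), res _, res _, res _, res _, res _, res _,
          res _⟩

theorem ncard_isBad {w : ℕ} (hw : Odd w) : {Δ : Set ℕ | IsPreModule w Δ ∧ IsBad w Δ}.ncard = 46 := by
  have himg : {Δ : Set ℕ | IsPreModule w Δ ∧ IsBad w Δ} =
      BadCode.toSet w '' (Finset.univ.filter fun c : BadCode => c.valid = true : Finset BadCode) := by
    ext Δ
    simp only [Set.mem_ofPred_eq, Finset.coe_filter, Finset.mem_univ, true_and, Set.mem_image]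
    constructor
    · rintro ⟨h1, h2⟩
      exact ⟨_, BadCode.toSet_ofSet hw h1 h2⟩
    · rintro ⟨c, hc, rfl⟩
      exact BadCode.toSet_spec hw hc
  rw [himg, Set.ncard_image_of_injective _ (Function.LeftInverse.injective (BadCode.ofSet_toSet hw)),
    Set.ncard_coe_finset, card_valid]

theorem not_isAdmissible_iff {w : ℕ} {hv : 9 ≤ w + 8} (hw : Odd w) {Δ : Set ℕ}
    (hΔ : IsPreModule w Δ) : ¬ IsAdmissible (w + 8) hv Δ ↔ IsBad w Δ := by
  refine ⟨fun h => ?_, hΔ.not_isAdmissible_of_isBad hw⟩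
  by_contra hbad
  exact h (hΔ.isAdmissible_of_not_isBad hv hw hbad)

end CompactifiedJacobian

theorem mainTheorem4 (v : ℕ) (hv : 9 ≤ v) (hodd : Odd v) :
    (∀ Δ : Set ℕ, CompactifiedJacobian.IsStandardModule v hv Δ →
      (¬ CompactifiedJacobian.IsAdmissible v hv Δ ↔
        ((∃ p ∈ ({2, 4, 10} : Set ℕ), CompactifiedJacobian.PairObstructed v hv Δ p 0) ∨
          CompactifiedJacobian.PairObstructed v hv Δ 4 2 ∨
          CompactifiedJacobian.TripleObstructed v hv Δ))) ∧
    {Δ : Set ℕ | CompactifiedJacobian.IsStandardModule v hv Δ ∧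
      ¬ CompactifiedJacobian.IsAdmissible v hv Δ}.ncard = 46 := by
  obtain ⟨w, rfl⟩ : ∃ w, v = w + 8 := ⟨v - 8, by omega⟩
  have hw : Odd w := by
    obtain ⟨t, ht⟩ := hodd
    exact ⟨t - 4, by omega⟩
  refine ⟨fun Δ hΔ => ?_, ?_⟩
  · have hpre := hΔ.isPreModule
    rw [CompactifiedJacobian.not_isAdmissible_iff hw hpre]
    exact ⟨CompactifiedJacobian.obstructed_of_isBad hw hpre.zero_mem, hpre.isBad_of_obstructed hw⟩
  · rw [← CompactifiedJacobian.ncard_isBad hw]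
    congr 1
    ext Δ
    constructor
    · rintro ⟨hΔ, hne⟩
      exact ⟨hΔ.isPreModule, (CompactifiedJacobian.not_isAdmissible_iff hw hΔ.isPreModule).mp hne⟩
    · rintro ⟨hΔ, hbad⟩
      exact ⟨hΔ.isStandardModule hw, (CompactifiedJacobian.not_isAdmissible_iff hw hΔ).mpr hbad⟩
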